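/- **Theorem (Boundedness II).** Let $N\ge 1$, $1<p<\infty$, $\lambda\in\mathbb R$; for $\alpha>0$ put $p_\alpha:=\frac{p\alpha}{\alpha+1}$, and $\alpha^*:=\frac{N\alpha}{N-\alpha}$ if $\alpha<N$, $\alpha^*:=\infty$ if $\alpha\ge N$. For $0<R_1<R_2\le\infty$ let $A_{R_1}^{R_2}:=\{x\in\mathbb R^N: R_1<|x|<R_2\}$. Let $L,K$ be measurable on $A_{R_1}^{R_2}$, with $L>0$ a.e., $L\in L^1_{\rm loc}(A_{R_1}^{R_2})$ and $|\{x\in A_{R_1}^{R_2}:K(x)>0\}|>0$. Assume (A) there are functions $v,w$, measurable and positive a.e. in $(R_1,R_2)$, such that $v^{-\frac1{p-1}},w\in L^1_{\rm loc}(R_1,R_2)$ and, with $p'=\frac p{p-1}$, $\rho(r)=r^{N-1}v(r)$, $\sigma(r)=r^{N-1}w(r)$: (i) $P(r):=\min\Big\{\big(\int_{R_1}^r\rho^{1-p'}(\tau)\,d\tau\big)^{p-1},\big(\int_r^{R_2}\rho^{1-p'}(\tau)\,d\tau\big)^{p-1}\Big\}<\infty$ for all $r\in(R_1,R_2)$,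 and $\int_{R_1}^{R_2}P(r)\sigma(r)\,dr<\infty$; (ii) $L(x)\ge v(|x|)$ and $|K(x)|\le w(|x|)$ for a.e. $x\in A_{R_1}^{R_2}$. Let $\mathcal D_0^{1,p}(A_{R_1}^{R_2};L)$ be the completion of $C_c^1(A_{R_1}^{R_2})$ in the norm $\big(\int_{A_{R_1}^{R_2}}L|\nabla u|^p\,dx\big)^{1/p}$ (a space of functions under (A)). A solution is a function $u\in\mathcal D_0^{1,p}(A_{R_1}^{R_2};L)$ with $$\int_{A_{R_1}^{R_2}}L|\nabla u|^{p-2}\nabla u\cdot\nabla\psi\,dx=\lambda\int_{A_{R_1}^{R_2}}K|u|^{p-2}u\,\psi\,dx\qquad\text{for all }\psi\in\mathcal D_0^{1,p}(A_{R_1}^{R_2};L).$$ Let $s\in(\frac Np,\infty)\cap[\frac1{p-1},\infty)$ and $q\in[p,p_s^*)$, with the conventions $\frac q{q-p}:=\infty$ if $q=p$ and $\frac{q}{\infty}:=0$. (1) Let $B(x_0,r_0)\subset A_{R_1}^{R_2}$, $r_0>0$, be a ball with $L^{-s}\in L^1(B(x_0,r_0))$ and $L,K\in L^{\frac q{q-p}}(B(x_0,r_0))$.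 Then for every $\mu\in(0,1-\frac q{p_s^*})$ there is a constant $C=C(\mu,r_0)>0$, which besides $\mu$ and $r_0$ depends only on $N,p,q,s,\lambda$ (not on $R_1,R_2,L,K,x_0$), such that every solution $u$ belongs to $L^q(B(x_0,r_0))\cap L^\infty(B(x_0,\frac{r_0}2))$ and satisfies $$\|u\|_{L^\infty(B(x_0,\frac{r_0}2))}\le C\,M_{L,K}\Big(\int_{B(x_0,r_0)}|u|^q\,dx\Big)^{\frac1q},$$ $$M_{L,K}:=\Big(\int_{B(x_0,r_0)}L^{-s}\,dx\Big)^{\frac1{\mu sp}}\Big[\|L\|_{L^{\frac q{q-p}}(B(x_0,r_0))}+\|K\|_{L^{\frac q{q-p}}(B(x_0,r_0))}\Big]^{\frac1{\mu p}}.$$ (2) If $L^{-s}\in L^1_{\rm loc}(A_{R_1}^{R_2})$ and $L,K\in L^{\frac q{q-p}}_{\rm loc}(A_{R_1}^{R_2})$, then every solution belongs to $L^\infty_{\rm loc}(A_{R_1}^{R_2})$. -/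

import Mathlib

open MeasureTheory Filter Topology Set
open scoped ENNReal

namespace WeightedPLaplacian

noncomputable section

/-- The domain `{x ∈ ℝ^N : R₁ < |x| < R₂}`, where `R₂ = ⊤` is allowed. -/
def annulus (N : ℕ) (R₁ : ℝ) (R₂ : EReal) : Set (EuclideanSpace ℝ (Fin N)) :=
  {x | R₁ < ‖x‖ ∧ ((‖x‖ : ℝ) : EReal) < R₂}

/-- The interval `(R₁, R₂)` of radii, where `R₂ = ⊤` is allowed. -/
def radii (R₁ : ℝ) (R₂ : EReal) : Set ℝ :=
  {r | R₁ < r ∧ (r : EReal) < R₂}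

/-- `p_s = p s / (s + 1)`. -/
def pSub (p s : ℝ) : ℝ := p * s / (s + 1)

/-- The Sobolev exponent `α^* = N α / (N - α)` if `α < N`, and `∞` otherwise. -/
def sobolevExponent (N : ℕ) (α : ℝ) : ℝ≥0∞ :=
  if α < N then ENNReal.ofReal (N * α / (N - α)) else ⊤

/-- The exponent `q / (q - p)` for `1 < p ≤ q`; it is `∞` when `q = p`. -/
def weightExponent (p q : ℝ) : ℝ≥0∞ := ENNReal.ofReal q / ENNReal.ofReal (q - p)

/-- The radial function `ρ^{1-p'}`, with `ρ(r) = r^{N-1} v(r)` and `p' = p / (p - 1)`. -/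
def rhoPow (N : ℕ) (p : ℝ) (v : ℝ → ℝ) (r : ℝ) : ℝ :=
  (r ^ (N - 1) * v r) ^ (1 - p / (p - 1))

/-- `P(r) = min {(∫_{R₁}^r ρ^{1-p'})^{p-1}, (∫_r^{R₂} ρ^{1-p'})^{p-1}}`, possibly infinite. -/
def radialP (N : ℕ) (p R₁ : ℝ) (R₂ : EReal) (v : ℝ → ℝ) (r : ℝ) : ℝ≥0∞ :=
  min ((∫⁻ τ in radii R₁ (r : EReal), ENNReal.ofReal (rhoPow N p v τ)) ^ (p - 1))
    ((∫⁻ τ in radii r R₂, ENNReal.ofReal (rhoPow N p v τ)) ^ (p - 1))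

/-- The standing assumptions on the weights: `L` is measurable, positive a.e. and locally
integrable in the domain; `K` is measurable and positive on a set of positive measure. -/
structure Weights {N : ℕ} (R₁ : ℝ) (R₂ : EReal) (L K : EuclideanSpace ℝ (Fin N) → ℝ) :
    Prop where
  aemeasurable_L : AEMeasurable L (volume.restrict (annulus N R₁ R₂))
  pos_L : ∀ᵐ x ∂volume.restrict (annulus N R₁ R₂), 0 < L x
  locallyIntegrable_L : LocallyIntegrableOn L (annulus N R₁ R₂)
  aemeasurable_K : AEMeasurable K (volume.restrict (annulus N R₁ R₂))
  pos_K : 0 < volume {x ∈ annulus N R₁ R₂ | 0 < K x}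

/-- Condition (A) for given radial functions `v`, `w` (with `σ(r) = r^{N-1} w(r)`). -/
structure RadialBounds {N : ℕ} (p R₁ : ℝ) (R₂ : EReal) (L K : EuclideanSpace ℝ (Fin N) → ℝ)
    (v w : ℝ → ℝ) : Prop where
  aemeasurable_v : AEMeasurable v (volume.restrict (radii R₁ R₂))
  aemeasurable_w : AEMeasurable w (volume.restrict (radii R₁ R₂))
  pos_v : ∀ᵐ r ∂volume.restrict (radii R₁ R₂), 0 < v r
  pos_w : ∀ᵐ r ∂volume.restrict (radii R₁ R₂), 0 < w r
  locallyIntegrable_v : LocallyIntegrableOn (fun r => v r ^ (-(1 / (p - 1)))) (radii R₁ R₂)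
  locallyIntegrable_w : LocallyIntegrableOn w (radii R₁ R₂)
  finite_P : ∀ r ∈ radii R₁ R₂, radialP N p R₁ R₂ v r < ⊤
  finite_integral :
    ∫⁻ r in radii R₁ R₂, radialP N p R₁ R₂ v r * ENNReal.ofReal (r ^ (N - 1) * w r) < ⊤
  le_L : ∀ᵐ x ∂volume.restrict (annulus N R₁ R₂), v ‖x‖ ≤ L x
  abs_K_le : ∀ᵐ x ∂volume.restrict (annulus N R₁ R₂), |K x| ≤ w ‖x‖

/-- Condition (A). -/
def ConditionA {N : ℕ} (p R₁ : ℝ) (R₂ : EReal) (L K : EuclideanSpace ℝ (Fin N) → ℝ) : Prop :=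
  ∃ v w : ℝ → ℝ, RadialBounds p R₁ R₂ L K v w

/-- `φ ∈ C_c^1(Ω)`. -/
def IsCc1 {N : ℕ} (Ω : Set (EuclideanSpace ℝ (Fin N))) (φ : EuclideanSpace ℝ (Fin N) → ℝ) :
    Prop :=
  ContDiff ℝ 1 φ ∧ HasCompactSupport φ ∧ tsupport φ ⊆ Ω

/-- `u ∈ 𝒟₀^{1,p}(Ω; L)`, with gradient `∇u = G`. The space is the completion of `C_c^1(Ω)` for
the norm `(∫_Ω L |∇φ|^p)^{1/p}`. It is realized as a space of functions: `u` is the limit in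
`L^1_loc(Ω)` and `G` is the limit of the gradients in the `L`-weighted `L^p` space over `Ω` of one
and the same sequence in `C_c^1(Ω)`. On the annulus, under condition (A), a sequence which is
Cauchy for the norm converges in `L^1_loc`, `u` determines `G` a.e. and `G` is the weak gradient
of `u`. -/
def MemD {N : ℕ} (p : ℝ) (Ω : Set (EuclideanSpace ℝ (Fin N)))
    (L : EuclideanSpace ℝ (Fin N) → ℝ) (u : EuclideanSpace ℝ (Fin N) → ℝ)
    (G : EuclideanSpace ℝ (Fin N) → EuclideanSpace ℝ (Fin N)) : Prop :=
  AEStronglyMeasurable u (volume.restrict Ω) ∧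
  AEStronglyMeasurable G (volume.restrict Ω) ∧
  ∃ φ : ℕ → EuclideanSpace ℝ (Fin N) → ℝ,
    (∀ n, IsCc1 Ω (φ n)) ∧
    (∀ S ⊆ Ω, IsCompact S →
      Tendsto (fun n => ∫⁻ x in S, ENNReal.ofReal |φ n x - u x|) atTop (𝓝 0)) ∧
    Tendsto (fun n => ∫⁻ x in Ω, ENNReal.ofReal (L x * ‖gradient (φ n) x - G x‖ ^ p))
      atTop (𝓝 0)

/-- `u` is a weak solution of `-div(L |∇u|^{p-2} ∇u) = lam K |u|^{p-2} u` in `Ω`, `u = 0` on `∂Ω`: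
it lies in `𝒟₀^{1,p}(Ω; L)` and satisfies the integral identity for all test functions `ψ` in this
space (with gradient `H`). -/
def IsWeakSolution {N : ℕ} (p lam : ℝ) (Ω : Set (EuclideanSpace ℝ (Fin N)))
    (L K : EuclideanSpace ℝ (Fin N) → ℝ) (u : EuclideanSpace ℝ (Fin N) → ℝ) : Prop :=
  ∃ G : EuclideanSpace ℝ (Fin N) → EuclideanSpace ℝ (Fin N), MemD p Ω L u G ∧
    ∀ (ψ : EuclideanSpace ℝ (Fin N) → ℝ)
      (H : EuclideanSpace ℝ (Fin N) → EuclideanSpace ℝ (Fin N)), MemD p Ω L ψ H →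
      ∫ x in Ω, L x * ‖G x‖ ^ (p - 2) * inner ℝ (G x) (H x) =
        lam * ∫ x in Ω, K x * |u x| ^ (p - 2) * u x * ψ x

/-- The constant
`M_{L,K} = (∫_B L^{-s})^{1/(μsp)} (‖L‖_{L^{q/(q-p)}(B)} + ‖K‖_{L^{q/(q-p)}(B)})^{1/(μp)}`. -/
def weightConstant {N : ℕ} (p q s μ : ℝ) (B : Set (EuclideanSpace ℝ (Fin N)))
    (L K : EuclideanSpace ℝ (Fin N) → ℝ) : ℝ≥0∞ :=
  (∫⁻ x in B, ENNReal.ofReal (L x ^ (-s))) ^ (1 / (μ * s * p)) *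
    (eLpNorm L (weightExponent p q) (volume.restrict B) +
      eLpNorm K (weightExponent p q) (volume.restrict B)) ^ (1 / (μ * p))

end

end WeightedPLaplacian

namespace WeightedPLaplacian

noncomputable section

/-! ### Subcritical Sobolev and Poincaré inequalities on balls -/

section SobolevPoincare

variable {E : Type*} [NormedAddCommGroup E] [NormedSpace ℝ E] [FiniteDimensional ℝ E]
  [MeasurableSpace E] [BorelSpace E] (μ : Measure E) [μ.IsAddHaarMeasure]

open Module (finrank)

/-! The proof is a Moser iteration. Hölder's inequality with `L^{-s}` integrable
(`lintegral_rpow_pSub_le`) trades the weighted `p`-energy for an unweighted gradient norm in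
`L^{p_s}`, and `s ≥ 1/(p-1)` means `p_s ≥ 1`. A Sobolev inequality then reaches every exponent `τ ≥
p_s`, `τ > 1`, with `N(1/p_s - 1/τ) < 1`. As this is strictly subcritical, it has an elementary
proof: integrate the derivative along segments, average over endpoints and use scaling
(`exists_lintegral_rpow_lintegral_le`).

Elements of the energy space are only limits of `C_c^1` functions. On a ball where `L^{-s}` is
integrable, the approximating sequence can be taken to converge also in `L^q` and a.e.
(`MemD.exists_isApprox`). Hence `ζ Φ(u)` is an admissible test function when `Φ'` is bounded and
continuous (`IsApprox.memD_mul_comp`), and it inherits the Sobolev inequality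
(`IsApprox.lintegral_mul_comp_rpow_le`).

Let `d` be the derivative of `|t|^β` up to sign, truncated at height `m`. Testing with `η^p ∫ d^p`
gives a Caccioppoli inequality (`IsApprox.caccioppoli`). Hölder with `L, K` in `L^{q/(q-p)}` bounds
its right side by the `L^{βq}` norm of `u`, while Sobolev applied to `η ∫ d` bounds the `L^{βτ}`
norm from above. Letting `m → ∞` gives one step from `βq` to `βτ` on a smaller ball
(`exists_lintegral_rpow_le_moser`).

With `τ = q/(1-μ)` and `β = (1-μ)^{-k}` at step `k`, the weight factor enters with exponent
`(1-μ)^k/p`. These exponents sum to `1/(μp)`, which is the power in the estimate; the losses from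
shrinking radii and growing `β` contribute a convergent series `∑ k (1-μ)^k`
(`exists_eLpNorm_top_le`). The condition on `μ` says exactly that `τ` is below the Sobolev exponent.
Local boundedness follows by covering compact sets with balls. -/

theorem lintegral_comp_smul_add {g : E → ℝ≥0∞} (hg : Measurable g) {c : ℝ} (hc : 0 < c) (v : E) :
    ∫⁻ x, g (c • x + v) ∂μ = ENNReal.ofReal c ^ (-(finrank ℝ E : ℝ)) * ∫⁻ x, g x ∂μ := by
  have h1 : ∫⁻ x, g (c • x + v) ∂μ = ∫⁻ y, g (y + v) ∂(Measure.map (fun x => c • x) μ) := by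
    rw [lintegral_map (by fun_prop) (by fun_prop)]
  rw [h1, Measure.map_addHaar_smul μ hc.ne', lintegral_smul_measure, lintegral_add_right_eq_self,
    smul_eq_mul, abs_of_pos (by positivity), ENNReal.ofReal_inv_of_pos (by positivity),
    ENNReal.ofReal_pow hc.le, ENNReal.rpow_neg, ENNReal.rpow_natCast]

theorem ofReal_rpow_neg_le_two_pow {c : ℝ} (hc : 1 / 2 ≤ c) (n : ℕ) :
    ENNReal.ofReal c ^ (-(n : ℝ)) ≤ 2 ^ n := by
  rw [ENNReal.rpow_neg, ENNReal.rpow_natCast, ENNReal.inv_pow]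
  gcongr
  rw [ENNReal.inv_le_iff_inv_le, show (2 : ℝ≥0∞)⁻¹ = ENNReal.ofReal (1 / 2) by
    rw [one_div, ENNReal.ofReal_inv_of_pos (by norm_num), ENNReal.ofReal_ofNat]]
  exact ENNReal.ofReal_le_ofReal hc

/-- One of the coefficients `t`, `1 - t` is at least `1/2`. Substituting in the variable that
carries it costs a Jacobian of at most `2^n`, so the bound is uniform in `t`. -/
theorem lintegral_lintegral_comp_lineMap_le {g : E → ℝ≥0∞} (hg : Measurable g) {A B : Set E}
    {M : ℝ≥0∞} (hA : μ A ≤ M) (hB : μ B ≤ M) {t : ℝ} (ht0 : 0 < t) (ht1 : t < 1) :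
    ∫⁻ x in A, ∫⁻ z in B, g ((1 - t) • x + t • z) ∂μ ∂μ ≤
      M * 2 ^ finrank ℝ E * ∫⁻ x, g x ∂μ := by
  rcases le_total t (1 / 2) with h | h
  · rw [lintegral_lintegral_swap]
    · calc _ ≤ ∫⁻ z in B, 2 ^ finrank ℝ E * ∫⁻ x, g x ∂μ ∂μ := by
            gcongr with z
            refine (setLIntegral_le_lintegral _ _).trans ?_
            rw [lintegral_comp_smul_add μ hg (by linarith)]
            gcongr
            exact ofReal_rpow_neg_le_two_pow (by linarith) _
        _ ≤ _ := by
            rw [setLIntegral_const, mul_comm, mul_assoc]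
            gcongr
    · exact Measurable.aemeasurable (by unfold Function.uncurry; fun_prop)
  · calc _ ≤ ∫⁻ x in A, 2 ^ finrank ℝ E * ∫⁻ x, g x ∂μ ∂μ := by
            gcongr with x
            refine (setLIntegral_le_lintegral _ _).trans ?_
            simp_rw [add_comm ((1 - t) • x)]
            rw [lintegral_comp_smul_add μ hg (by linarith)]
            gcongr
            exact ofReal_rpow_neg_le_two_pow (by linarith) _
        _ ≤ _ := by
            rw [setLIntegral_const, mul_comm, mul_assoc]
            gcongr

theorem lintegral_rpow_le_measure_mul {α : Type*} [MeasurableSpace α] {ν : Measure α}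
    {g : α → ℝ≥0∞} (hg : AEMeasurable g ν) {a : ℝ} (ha : 1 ≤ a) :
    (∫⁻ x, g x ∂ν) ^ a ≤ ν univ ^ (a - 1) * ∫⁻ x, g x ^ a ∂ν := by
  have ha0 : 0 < a := by linarith
  have h := ENNReal.lintegral_mul_norm_pow_le (μ := ν) (f := fun x => g x ^ a) (g := fun _ => 1)
    (hg.pow_const a) aemeasurable_const (p := 1 / a) (q := 1 - 1 / a) (by positivity)
    (by rw [sub_nonneg, div_le_one ha0]; exact ha) (by ring)
  simp only [← ENNReal.rpow_mul, ENNReal.one_rpow, mul_one, lintegral_const, one_mul,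
    mul_one_div_cancel ha0.ne', ENNReal.rpow_one] at h
  calc _ ≤ _ := ENNReal.rpow_le_rpow h ha0.le
    _ = _ := by
      rw [ENNReal.mul_rpow_of_nonneg _ _ ha0.le, ← ENNReal.rpow_mul, ← ENNReal.rpow_mul, mul_comm]
      congr 2
      · field_simp
      · rw [one_div_mul_cancel ha0.ne', ENNReal.rpow_one]

/-- The averages of `g` over the sets `(1 - t) x + t B` are bounded in `L^τ`, with the rate in `t`
which is given by scaling. -/
theorem lintegral_rpow_lintegral_comp_lineMap_le {g : E → ℝ≥0∞} (hg : Measurable g) {A B : Set E}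
    {M : ℝ≥0∞} (hA : μ A ≤ M) (hB : μ B ≤ M) {t : ℝ} (ht0 : 0 < t) (ht1 : t < 1)
    {a τ : ℝ} (ha : 1 ≤ a) (haτ : a ≤ τ) :
    ∫⁻ x in A, (∫⁻ z in B, g ((1 - t) • x + t • z) ∂μ) ^ τ ∂μ ≤
      (M ^ (a - 1)) ^ ((τ - a) / a) * (M ^ (a - 1) * (M * 2 ^ finrank ℝ E)) *
        ENNReal.ofReal t ^ (-(finrank ℝ E * ((τ - a) / a))) * (∫⁻ x, g x ^ a ∂μ) ^ (τ / a) := by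
  have ha0 : 0 < a := by linarith
  set I := ∫⁻ x, g x ^ a ∂μ
  set n := finrank ℝ E
  have e0 : 0 ≤ (τ - a) / a := div_nonneg (by linarith) ha0.le
  have jensen : ∀ x, (∫⁻ z in B, g ((1 - t) • x + t • z) ∂μ) ^ a ≤
      M ^ (a - 1) * ∫⁻ z in B, g ((1 - t) • x + t • z) ^ a ∂μ := fun x => by
    refine (lintegral_rpow_le_measure_mul (by fun_prop) ha).trans ?_
    rw [Measure.restrict_apply_univ]
    gcongr
  have sup : ∀ x, (∫⁻ z in B, g ((1 - t) • x + t • z) ∂μ) ^ a ≤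
      M ^ (a - 1) * (ENNReal.ofReal t ^ (-(n : ℝ)) * I) := fun x => by
    refine (jensen x).trans ?_
    gcongr
    refine (setLIntegral_le_lintegral _ _).trans ?_
    simp_rw [add_comm ((1 - t) • x)]
    rw [lintegral_comp_smul_add μ (hg.pow_const a) ht0]
  -- Interpolation: write `τ = a·(τ-a)/a + a`, bound the first power uniformly in `x` by `sup` (this
  -- produces the singular power of `t`), and keep the second for integration in `x`, where the
  -- bound is uniform in `t`.
  have pt : ∀ x, (∫⁻ z in B, g ((1 - t) • x + t • z) ∂μ) ^ τ ≤
      (M ^ (a - 1) * (ENNReal.ofReal t ^ (-(n : ℝ)) * I)) ^ ((τ - a) / a) *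
        (M ^ (a - 1) * ∫⁻ z in B, g ((1 - t) • x + t • z) ^ a ∂μ) := fun x => by
    calc _ = ((∫⁻ z in B, g ((1 - t) • x + t • z) ∂μ) ^ a) ^ ((τ - a) / a) *
          (∫⁻ z in B, g ((1 - t) • x + t • z) ∂μ) ^ a := by
          rw [← ENNReal.rpow_mul, ← ENNReal.rpow_add_of_nonneg _ _ (by positivity) ha0.le]
          congr 1
          field_simp
          ring
      _ ≤ _ := by
          gcongr
          · exact sup x
          · exact jensen x
  calc _ ≤ _ := lintegral_mono pt
    _ = (M ^ (a - 1) * (ENNReal.ofReal t ^ (-(n : ℝ)) * I)) ^ ((τ - a) / a) *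
        (M ^ (a - 1) * ∫⁻ x in A, ∫⁻ z in B, g ((1 - t) • x + t • z) ^ a ∂μ ∂μ) := by
      have : Measurable fun x => ∫⁻ z in B, g ((1 - t) • x + t • z) ^ a ∂μ :=
        Measurable.lintegral_prod_right' (f := fun w : E × E => g ((1 - t) • w.1 + t • w.2) ^ a)
          (by fun_prop)
      rw [lintegral_const_mul _ (this.const_mul _), lintegral_const_mul _ this]
    _ ≤ (M ^ (a - 1) * (ENNReal.ofReal t ^ (-(n : ℝ)) * I)) ^ ((τ - a) / a) *
        (M ^ (a - 1) * (M * 2 ^ n * I)) := by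
      gcongr
      exact lintegral_lintegral_comp_lineMap_le μ (hg.pow_const a) hA hB ht0 ht1
    _ = _ := by
      rw [ENNReal.mul_rpow_of_nonneg _ _ e0, ENNReal.mul_rpow_of_nonneg _ _ e0, ← ENNReal.rpow_mul,
        ← ENNReal.rpow_mul (ENNReal.ofReal t)]
      have : I ^ (τ / a) = I ^ ((τ - a) / a) * I := by
        nth_rw 3 [← ENNReal.rpow_one I]
        rw [← ENNReal.rpow_add_of_nonneg _ _ e0 zero_le_one]
        congr 1
        field_simp
        ring
      rw [this, neg_mul]
      ring

theorem lintegral_ofReal_rpow_lt_top {b : ℝ} (hb : -1 < b) :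
    ∫⁻ t in Ioo (0 : ℝ) 1, ENNReal.ofReal t ^ b < ⊤ := by
  have h := (intervalIntegral.integrableOn_Ioo_rpow_iff zero_lt_one).2 hb
  have := h.2
  rw [hasFiniteIntegral_iff_enorm] at this
  refine lt_of_eq_of_lt (setLIntegral_congr_fun measurableSet_Ioo fun t ht => ?_) this
  have ht := ht.1
  rw [Real.enorm_of_nonneg (by positivity), ENNReal.ofReal_rpow_of_pos ht]

theorem enorm_sub_le_lintegral_fderiv {f : E → ℝ} (hf : ContDiff ℝ 1 f) (x z : E) :
    ‖f x - f z‖ₑ ≤ ‖x - z‖ₑ * ∫⁻ t in Ioo (0 : ℝ) 1, ‖fderiv ℝ f ((1 - t) • x + t • z)‖ₑ := by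
  have hd : ∀ t : ℝ, HasDerivAt (fun t : ℝ => f ((1 - t) • x + t • z))
      (fderiv ℝ f ((1 - t) • x + t • z) (z - x)) t := fun t => by
    have h1 : HasDerivAt (fun t : ℝ => (1 - t) • x + t • z) (z - x) t := by
      have := (((hasDerivAt_id t).const_sub 1).smul_const x).add ((hasDerivAt_id t).smul_const z)
      refine this.congr_deriv ?_
      simp [sub_eq_neg_add]
    exact ((hf.differentiable one_ne_zero _).hasFDerivAt.comp_hasDerivAt t h1)
  have hc : Continuous fun t : ℝ => fderiv ℝ f ((1 - t) • x + t • z) :=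
    (hf.continuous_fderiv one_ne_zero).comp (by fun_prop)
  have h := intervalIntegral.integral_eq_sub_of_hasDerivAt (a := 0) (b := 1) (fun t _ => hd t)
    ((hc.clm_apply continuous_const).intervalIntegrable 0 1)
  simp only [sub_zero, one_smul, zero_smul, add_zero, sub_self, zero_add] at h
  rw [enorm_sub_rev, ← h, intervalIntegral.integral_of_le zero_le_one,
    integral_Ioc_eq_integral_Ioo, ← lintegral_const_mul _ (by fun_prop)]
  refine (enorm_integral_le_lintegral_enorm _).trans (lintegral_mono fun t => ?_)
  dsimp only
  rw [enorm_sub_rev, mul_comm]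
  exact ContinuousLinearMap.le_opENorm _ _

/-- The difference `f x - f z` is an integral of the gradient over the segment. For fixed `t`, the
average over `z` has an `L^τ` norm of order `t^{-n(1/a - 1/τ)}`, which is integrable at `0`
precisely by the subcriticality assumption. Both inequalities below follow by choosing `B` suitably.
-/
theorem exists_lintegral_rpow_lintegral_le {a τ d : ℝ} {M : ℝ≥0∞} (ha : 1 ≤ a) (haτ : a ≤ τ)
    (hτ : 1 < τ) (hκ : finrank ℝ E * (1 / a - 1 / τ) < 1) (hM : M ≠ ⊤) :
    ∃ C : ℝ≥0∞, C ≠ ⊤ ∧ ∀ s B : Set E, Convex ℝ s → MeasurableSet s → B ⊆ s →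
      MeasurableSet B → μ s ≤ M → (∀ x ∈ s, ∀ z ∈ s, ‖x - z‖ ≤ d) → ∀ f : E → ℝ, ContDiff ℝ 1 f →
      ∫⁻ x in s, (∫⁻ z in B, ‖f x - f z‖ₑ ∂μ) ^ τ ∂μ ≤
        C * (∫⁻ x in s, ‖fderiv ℝ f x‖ₑ ^ a ∂μ) ^ (τ / a) := by
  have ha0 : 0 < a := by linarith
  have hτ0 : 0 < τ := by linarith
  set n := finrank ℝ E
  -- The midpoint of the interval from `n(1/a - 1/τ) - 1/τ` to `1 - 1/τ`, nonempty by `hκ`. The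
  -- upper bound on `b` makes `K₁` finite, the lower bound makes `K₂` finite.
  set b : ℝ := (1 + n * (1 / a - 1 / τ)) / 2 - 1 / τ with hb
  have hb1 : b < 1 - 1 / τ := by linarith
  have hb2 : n * (1 / a - 1 / τ) - 1 / τ < b := by linarith
  set K₁ := ∫⁻ t in Ioo (0 : ℝ) 1, ENNReal.ofReal t ^ (-b * (1 - 1 / τ)⁻¹) with hK₁
  set K₂ := ∫⁻ t in Ioo (0 : ℝ) 1, ENNReal.ofReal t ^ (b * τ - n * ((τ - a) / a)) with hK₂
  set C₁ := (M ^ (a - 1)) ^ ((τ - a) / a) * (M ^ (a - 1) * (M * 2 ^ n)) with hC₁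
  have hτ1 : 0 < 1 - 1 / τ := by
    rw [sub_pos, div_lt_one hτ0]; exact hτ
  have hK₁t : K₁ < ⊤ := lintegral_ofReal_rpow_lt_top (by
    rw [← div_eq_mul_inv, lt_div_iff₀ hτ1]; linarith)
  have hK₂t : K₂ < ⊤ := lintegral_ofReal_rpow_lt_top (by
    have : (n * (1 / a - 1 / τ) - 1 / τ) * τ < b * τ := by gcongr
    have e : (n * (1 / a - 1 / τ) - 1 / τ) * τ = n * ((τ - a) / a) - 1 := by field_simp
    linarith)
  have hC₁t : C₁ < ⊤ := by
    have : M < ⊤ := hM.lt_top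
    have h2 : M ^ (a - 1) < ⊤ := ENNReal.rpow_lt_top_of_nonneg (by linarith) hM
    refine ENNReal.mul_lt_top (ENNReal.rpow_lt_top_of_nonneg
      (div_nonneg (by linarith) ha0.le) h2.ne) (ENNReal.mul_lt_top h2 (ENNReal.mul_lt_top this ?_))
    finiteness
  refine ⟨ENNReal.ofReal d ^ τ * (K₁ ^ ((1 - 1 / τ) * τ) * (C₁ * K₂)), ?_, ?_⟩
  · refine ENNReal.mul_ne_top (ENNReal.rpow_ne_top_of_nonneg hτ0.le ENNReal.ofReal_ne_top)
      (ENNReal.mul_ne_top (ENNReal.rpow_ne_top_of_nonneg (by positivity) hK₁t.ne)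
        (ENNReal.mul_ne_top hC₁t.ne hK₂t.ne))
  intro s B hs hsm hBs hBm hsM hd f hf
  have hDc : Continuous fun x => fderiv ℝ f x := hf.continuous_fderiv one_ne_zero
  -- Extension by zero allows changes of variables over the whole space; nothing is lost, because by
  -- convexity the segments stay in `s`.
  set g : E → ℝ≥0∞ := s.indicator fun x => ‖fderiv ℝ f x‖ₑ with hgdef
  have hg : Measurable g := hDc.enorm.measurable.indicator hsm
  set I := ∫⁻ x, g x ^ a ∂μ with hI
  have hIs : I = ∫⁻ x in s, ‖fderiv ℝ f x‖ₑ ^ a ∂μ := by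
    rw [hI, ← lintegral_indicator hsm]
    refine lintegral_congr fun x => ?_
    by_cases hx : x ∈ s <;> simp [hgdef, hx, ha0]
  rw [← hIs]
  set H : ℝ → E → ℝ≥0∞ := fun t x => ∫⁻ z in B, g ((1 - t) • x + t • z) ∂μ with hH
  have hHm : Measurable (Function.uncurry H) := by
    refine Measurable.lintegral_prod_right'
      (f := fun w : (ℝ × E) × E => g ((1 - w.1.1) • w.1.2 + w.1.1 • w.2)) ?_
    fun_prop
  have hHt : ∀ x, Measurable fun t => H t x := fun x => hHm.comp (measurable_id.prodMk measurable_const)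
  have hpt : ∀ x ∈ s, ∫⁻ z in B, ‖f x - f z‖ₑ ∂μ ≤
      ENNReal.ofReal d * ∫⁻ t in Ioo (0 : ℝ) 1, H t x := fun x hx => by
    calc _ ≤ ∫⁻ z in B, (ENNReal.ofReal d *
          ∫⁻ t in Ioo (0 : ℝ) 1, g ((1 - t) • x + t • z)) ∂μ := by
          refine setLIntegral_mono' hBm fun z hz => (enorm_sub_le_lintegral_fderiv hf x z).trans ?_
          refine mul_le_mul' ?_ (setLIntegral_mono' measurableSet_Ioo fun t ht => ?_)
          · rw [← ofReal_norm]
            exact ENNReal.ofReal_le_ofReal (hd x hx z (hBs hz))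
          · rw [hgdef, indicator_of_mem]
            exact hs hx (hBs hz) (by linarith [ht.2]) ht.1.le (by ring)
      _ = _ := by
          rw [lintegral_const_mul]
          · rw [lintegral_lintegral_swap]
            exact Measurable.aemeasurable (by unfold Function.uncurry; fun_prop)
          · refine Measurable.lintegral_prod_right'
              (f := fun w : E × ℝ => g ((1 - w.2) • x + w.2 • w.1)) (by fun_prop)
  -- Hölder in `t` after inserting `1 = t^{-b} t^b`.
  have holder : ∀ x, (∫⁻ t in Ioo (0 : ℝ) 1, H t x) ^ τ ≤ K₁ ^ ((1 - 1 / τ) * τ) *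
      ∫⁻ t in Ioo (0 : ℝ) 1, ENNReal.ofReal t ^ (b * τ) * H t x ^ τ := fun x => by
    have h := ENNReal.lintegral_mul_norm_pow_le (μ := volume.restrict (Ioo (0 : ℝ) 1))
      (f := fun t => ENNReal.ofReal t ^ (-b * (1 - 1 / τ)⁻¹))
      (g := fun t => ENNReal.ofReal t ^ (b * τ) * H t x ^ τ) (by fun_prop)
      (by have := hHt x; fun_prop) (p := 1 - 1 / τ) (q := 1 / τ) hτ1.le (by positivity) (by ring)
    have e : ∫⁻ t in Ioo (0 : ℝ) 1, H t x = ∫⁻ t in Ioo (0 : ℝ) 1,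
        (ENNReal.ofReal t ^ (-b * (1 - 1 / τ)⁻¹)) ^ (1 - 1 / τ) *
          (ENNReal.ofReal t ^ (b * τ) * H t x ^ τ) ^ (1 / τ) := by
      refine setLIntegral_congr_fun measurableSet_Ioo fun t ht => ?_
      have h0 : ENNReal.ofReal t ≠ 0 := by simpa using ht.1
      rw [ENNReal.mul_rpow_of_nonneg _ _ (by positivity), ← ENNReal.rpow_mul, ← ENNReal.rpow_mul,
        ← ENNReal.rpow_mul, ← mul_assoc, ← ENNReal.rpow_add _ _ h0 ENNReal.ofReal_ne_top,
        mul_one_div_cancel hτ0.ne', ENNReal.rpow_one, mul_assoc b τ,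
        mul_one_div_cancel hτ0.ne', mul_assoc, inv_mul_cancel₀ hτ1.ne']
      simp
    rw [← e] at h
    calc _ ≤ _ := ENNReal.rpow_le_rpow h hτ0.le
      _ = _ := by
        rw [ENNReal.mul_rpow_of_nonneg _ _ hτ0.le, ← ENNReal.rpow_mul, ← ENNReal.rpow_mul,
          one_div_mul_cancel hτ0.ne', ENNReal.rpow_one]
  calc _ ≤ ∫⁻ x in s, ENNReal.ofReal d ^ τ * (K₁ ^ ((1 - 1 / τ) * τ) *
        ∫⁻ t in Ioo (0 : ℝ) 1, ENNReal.ofReal t ^ (b * τ) * H t x ^ τ) ∂μ := by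
        refine setLIntegral_mono' hsm fun x hx => ?_
        refine (ENNReal.rpow_le_rpow (hpt x hx) hτ0.le).trans ?_
        rw [ENNReal.mul_rpow_of_nonneg _ _ hτ0.le]
        gcongr
        exact holder x
    _ = ENNReal.ofReal d ^ τ * (K₁ ^ ((1 - 1 / τ) * τ) *
        ∫⁻ x in s, (∫⁻ t in Ioo (0 : ℝ) 1, ENNReal.ofReal t ^ (b * τ) * H t x ^ τ) ∂μ) := by
        have : Measurable fun x =>
            ∫⁻ t in Ioo (0 : ℝ) 1, ENNReal.ofReal t ^ (b * τ) * H t x ^ τ := by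
          refine Measurable.lintegral_prod_right'
            (f := fun w : E × ℝ => ENNReal.ofReal w.2 ^ (b * τ) * H w.2 w.1 ^ τ) ?_
          have : Measurable fun w : E × ℝ => H w.2 w.1 := hHm.comp measurable_swap
          fun_prop
        rw [lintegral_const_mul _ (this.const_mul _), lintegral_const_mul _ this]
    _ = ENNReal.ofReal d ^ τ * (K₁ ^ ((1 - 1 / τ) * τ) *
        ∫⁻ t in Ioo (0 : ℝ) 1, ENNReal.ofReal t ^ (b * τ) * ∫⁻ x in s, H t x ^ τ ∂μ) := by
        rw [lintegral_lintegral_swap]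
        · congr 2
          refine lintegral_congr fun t => ?_
          rw [lintegral_const_mul]
          exact (hHm.comp (measurable_const.prodMk measurable_id)).pow_const τ
        · have : Measurable fun w : E × ℝ => H w.2 w.1 := hHm.comp measurable_swap
          refine Measurable.aemeasurable ?_
          unfold Function.uncurry
          fun_prop
    _ ≤ ENNReal.ofReal d ^ τ * (K₁ ^ ((1 - 1 / τ) * τ) *
        ∫⁻ t in Ioo (0 : ℝ) 1, C₁ * I ^ (τ / a) *
          ENNReal.ofReal t ^ (b * τ - n * ((τ - a) / a))) := by
        refine mul_le_mul_right (mul_le_mul_right ?_ _) _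
        refine setLIntegral_mono' measurableSet_Ioo fun t ht => ?_
        have h0 : ENNReal.ofReal t ≠ 0 := by simpa using ht.1
        calc _ ≤ ENNReal.ofReal t ^ (b * τ) *
              (C₁ * ENNReal.ofReal t ^ (-(n * ((τ - a) / a))) * I ^ (τ / a)) := by
              gcongr
              exact lintegral_rpow_lintegral_comp_lineMap_le μ hg hsM
                ((measure_mono hBs).trans hsM) ht.1 ht.2 ha haτ
          _ = _ := by
              rw [sub_eq_add_neg (b * τ), ENNReal.rpow_add _ _ h0 ENNReal.ofReal_ne_top]
              ring
    _ = _ := by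
        rw [lintegral_const_mul _ (by fun_prop)]
        ring

/-- The Sobolev inequality for functions with support in a ball. -/
theorem exists_lintegral_rpow_le_of_tsupport_subset [Nontrivial E] {a τ r : ℝ} (ha : 1 ≤ a)
    (haτ : a ≤ τ) (hτ : 1 < τ) (hκ : finrank ℝ E * (1 / a - 1 / τ) < 1) (hr : 0 < r) :
    ∃ C : ℝ≥0∞, C ≠ ⊤ ∧ ∀ (x₀ : E) (f : E → ℝ), ContDiff ℝ 1 f →
      tsupport f ⊆ Metric.ball x₀ r →
      ∫⁻ x in Metric.ball x₀ r, ‖f x‖ₑ ^ τ ∂μ ≤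
        C * (∫⁻ x in Metric.ball x₀ r, ‖fderiv ℝ f x‖ₑ ^ a ∂μ) ^ (τ / a) := by
  have hτ0 : 0 < τ := by linarith
  obtain ⟨C, hC, h⟩ := exists_lintegral_rpow_lintegral_le μ (d := 6 * r)
    (M := μ (Metric.ball 0 (3 * r))) ha haτ hτ hκ measure_ball_lt_top.ne
  set m := μ (Metric.ball (0 : E) r)
  have hm0 : m ≠ 0 := (Metric.measure_ball_pos μ _ hr).ne'
  have hmt : m ≠ ⊤ := measure_ball_lt_top.ne
  have hmτ0 : m ^ τ ≠ 0 := by simp [ENNReal.rpow_eq_zero_iff, hm0, hmt]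
  have hmτt : m ^ τ ≠ ⊤ := ENNReal.rpow_ne_top_of_nonneg hτ0.le hmt
  refine ⟨(m ^ τ)⁻¹ * C, ENNReal.mul_ne_top (ENNReal.inv_ne_top.2 hmτ0) hC, fun x₀ f hf hsupp => ?_⟩
  -- A translated ball of the same radius, disjoint from the one carrying the support and inside the
  -- concentric ball of radius `3r`. On it `f = 0`, so the averaged difference is a multiple of `|f
  -- x|`.
  obtain ⟨e, he⟩ := exists_norm_eq E (c := 2 * r) (by positivity)
  have hB : Metric.ball (x₀ + e) r ⊆ Metric.ball x₀ (3 * r) :=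
    Metric.ball_subset_ball' (by simp [he]; linarith)
  have hdisj : Disjoint (Metric.ball x₀ r) (Metric.ball (x₀ + e) r) :=
    Metric.ball_disjoint_ball (by simp [he]; linarith)
  have hsub : Metric.ball x₀ r ⊆ Metric.ball x₀ (3 * r) := Metric.ball_subset_ball (by linarith)
  have h1 := h (Metric.ball x₀ (3 * r)) (Metric.ball (x₀ + e) r) (convex_ball _ _)
    measurableSet_ball hB measurableSet_ball (Measure.addHaar_ball_center μ _ _).le
    (fun x hx z hz => by
      rw [← dist_eq_norm]
      have := dist_triangle_right x z x₀
      rw [Metric.mem_ball] at hx hz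
      linarith) f hf
  have h2 : ∫⁻ x in Metric.ball x₀ (3 * r), ‖fderiv ℝ f x‖ₑ ^ a ∂μ ≤
      ∫⁻ x in Metric.ball x₀ r, ‖fderiv ℝ f x‖ₑ ^ a ∂μ := by
    rw [← lintegral_indicator (s := Metric.ball x₀ r) measurableSet_ball]
    refine (setLIntegral_le_lintegral _ _).trans (lintegral_mono fun x => ?_)
    by_cases hx : x ∈ Metric.ball x₀ r
    · rw [indicator_of_mem hx]
    · have : fderiv ℝ f x = 0 := by
        by_contra hne
        exact hx (hsupp (support_fderiv_subset ℝ hne))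
      rw [show ‖fderiv ℝ f x‖ₑ = 0 by
          rw [← ofReal_norm, this, norm_zero, ENNReal.ofReal_zero],
        ENNReal.zero_rpow_of_pos (by linarith)]
      exact zero_le
  have h3 : ∀ x, ∫⁻ z in Metric.ball (x₀ + e) r, ‖f x - f z‖ₑ ∂μ = m * ‖f x‖ₑ := fun x => by
    rw [setLIntegral_congr_fun (g := fun _ => ‖f x‖ₑ) measurableSet_ball, setLIntegral_const,
      Measure.addHaar_ball_center, mul_comm]
    intro z hz
    have : f z = 0 := by
      by_contra hne
      exact hdisj.le_bot ⟨hsupp (subset_tsupport _ hne), hz⟩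
    simp [this]
  replace h1 := h1.trans (mul_le_mul_right (ENNReal.rpow_le_rpow h2 (by positivity)) C)
  simp_rw [h3, ENNReal.mul_rpow_of_nonneg _ _ hτ0.le] at h1
  rw [lintegral_const_mul' _ _ hmτt] at h1
  rw [mul_assoc, ← ENNReal.div_eq_inv_mul, ENNReal.le_div_iff_mul_le (.inl hmτ0) (.inl hmτt),
    mul_comm]
  refine le_trans ?_ h1
  gcongr

/-- A Poincaré inequality on balls, where the mean over the ball is replaced by the `L¹` norm on the
ball of half the radius. -/
theorem exists_lintegral_ball_rpow_le {a τ r : ℝ} (ha : 1 ≤ a)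
    (haτ : a ≤ τ) (hτ : 1 < τ) (hκ : finrank ℝ E * (1 / a - 1 / τ) < 1) (hr : 0 < r) :
    ∃ C : ℝ≥0∞, C ≠ ⊤ ∧ ∀ (x₀ : E) (f : E → ℝ), ContDiff ℝ 1 f →
      ∫⁻ x in Metric.ball x₀ r, ‖f x‖ₑ ^ τ ∂μ ≤
        C * ((∫⁻ x in Metric.ball x₀ r, ‖fderiv ℝ f x‖ₑ ^ a ∂μ) ^ (τ / a) +
          (∫⁻ x in Metric.ball x₀ (r / 2), ‖f x‖ₑ ∂μ) ^ τ) := by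
  have hτ0 : 0 < τ := by linarith
  obtain ⟨C, hC, h⟩ := exists_lintegral_rpow_lintegral_le μ (d := 2 * r)
    (M := μ (Metric.ball 0 r)) ha haτ hτ hκ measure_ball_lt_top.ne
  set m := μ (Metric.ball (0 : E) (r / 2))
  set m' := μ (Metric.ball (0 : E) r)
  have hm't : m' ≠ ⊤ := measure_ball_lt_top.ne
  have hm0 : m ≠ 0 := (Metric.measure_ball_pos μ _ (by positivity)).ne'
  have hmt : m ≠ ⊤ := measure_ball_lt_top.ne
  have hmτ0 : m ^ τ ≠ 0 := by simp [ENNReal.rpow_eq_zero_iff, hm0, hmt]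
  have hmτt : m ^ τ ≠ ⊤ := ENNReal.rpow_ne_top_of_nonneg hτ0.le hmt
  have h2t : (2 : ℝ≥0∞) ^ (τ - 1) ≠ ⊤ := ENNReal.rpow_ne_top_of_nonneg (by linarith) (by simp)
  refine ⟨(m ^ τ)⁻¹ * (2 ^ (τ - 1) * (C + m')), by finiteness, fun x₀ f hf => ?_⟩
  have hsub : Metric.ball x₀ (r / 2) ⊆ Metric.ball x₀ r := Metric.ball_subset_ball (by linarith)
  have h1 := h (Metric.ball x₀ r) (Metric.ball x₀ (r / 2)) (convex_ball _ _)
    measurableSet_ball hsub measurableSet_ball (Measure.addHaar_ball_center μ _ _).le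
    (fun x hx z hz => by
      rw [← dist_eq_norm]
      have := dist_triangle_right x z x₀
      rw [Metric.mem_ball] at hx hz
      linarith) f hf
  set A := (∫⁻ x in Metric.ball x₀ r, ‖fderiv ℝ f x‖ₑ ^ a ∂μ) ^ (τ / a)
  set D := ∫⁻ x in Metric.ball x₀ (r / 2), ‖f x‖ₑ ∂μ
  have hfc := hf.continuous
  have h3 : ∀ x, m * ‖f x‖ₑ ≤ (∫⁻ z in Metric.ball x₀ (r / 2), ‖f x - f z‖ₑ ∂μ) + D := fun x => by
    rw [← lintegral_add_left (by fun_prop), show m = μ (Metric.ball x₀ (r / 2)) from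
      (Measure.addHaar_ball_center μ x₀ _).symm, mul_comm, ← setLIntegral_const]
    refine lintegral_mono fun z => ?_
    calc ‖f x‖ₑ = ‖(f x - f z) + f z‖ₑ := by simp
      _ ≤ _ := enorm_add_le _ _
  rw [mul_assoc, ← ENNReal.div_eq_inv_mul, ENNReal.le_div_iff_mul_le (.inl hmτ0) (.inl hmτt),
    mul_comm, ← lintegral_const_mul' _ _ hmτt]
  calc _ ≤ ∫⁻ x in Metric.ball x₀ r, 2 ^ (τ - 1) *
        ((∫⁻ z in Metric.ball x₀ (r / 2), ‖f x - f z‖ₑ ∂μ) ^ τ + D ^ τ) ∂μ := by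
        refine lintegral_mono fun x => ?_
        rw [← ENNReal.mul_rpow_of_nonneg _ _ hτ0.le]
        exact (ENNReal.rpow_le_rpow (h3 x) hτ0.le).trans
          (ENNReal.rpow_add_le_mul_rpow_add_rpow _ _ hτ.le)
    _ = 2 ^ (τ - 1) * ((∫⁻ x in Metric.ball x₀ r,
        (∫⁻ z in Metric.ball x₀ (r / 2), ‖f x - f z‖ₑ ∂μ) ^ τ ∂μ) + D ^ τ * m') := by
        rw [lintegral_const_mul' _ _ h2t, lintegral_add_right _ measurable_const,
          setLIntegral_const, Measure.addHaar_ball_center]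
    _ ≤ 2 ^ (τ - 1) * (C * A + D ^ τ * m') := by gcongr
    _ ≤ _ := by
        rw [mul_assoc]
        refine mul_le_mul_right ?_ _
        rw [add_mul, mul_add, mul_add, mul_comm (D ^ τ)]
        exact add_le_add le_self_add le_add_self

end SobolevPoincare

/-! ### Hölder inequalities with weights and finiteness of the energy -/

section

section Weighted

variable {α : Type*} [MeasurableSpace α] {ν : Measure α}

theorem tendsto_rpow_nhds_zero {ι : Type*} {l : Filter ι} {f : ι → ℝ≥0∞} (hf : Tendsto f l (𝓝 0))
    {y : ℝ} (hy : 0 < y) : Tendsto (fun i => f i ^ y) l (𝓝 0) := by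
  have := (ENNReal.continuous_rpow_const (y := y)).tendsto 0 |>.comp hf
  rwa [ENNReal.zero_rpow_of_pos hy] at this

theorem tendsto_const_mul_nhds_zero {ι : Type*} {l : Filter ι} {f : ι → ℝ≥0∞}
    (hf : Tendsto f l (𝓝 0)) {c : ℝ≥0∞} (hc : c ≠ ⊤) : Tendsto (fun i => c * f i) l (𝓝 0) := by
  simpa using ENNReal.Tendsto.const_mul hf (.inr hc)

theorem ofReal_mul_norm_rpow {F : Type*} [NormedAddCommGroup F] (c : ℝ) (v : F) {p : ℝ}
    (hp : 0 ≤ p) : ENNReal.ofReal (c * ‖v‖ ^ p) = ENNReal.ofReal c * ‖v‖ₑ ^ p := by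
  rw [ENNReal.ofReal_mul' (by positivity), ← ENNReal.ofReal_rpow_of_nonneg (norm_nonneg v) hp,
    ofReal_norm]

/-- Hölder with exponents `s + 1` and `(s + 1)/s`, applied to `F^{p_s} = (ℓ^{-s})^{1/(s+1)} (ℓ
F^p)^{s/(s+1)}`. This is the only way in which integrability of `L^{-s}` enters. -/
theorem lintegral_rpow_pSub_le {ℓ F : α → ℝ≥0∞} (hℓ : AEMeasurable ℓ ν) (hF : AEMeasurable F ν)
    (hℓ0 : ∀ᵐ x ∂ν, ℓ x ≠ 0) (hℓt : ∀ᵐ x ∂ν, ℓ x ≠ ⊤) {p s : ℝ} (hs : 0 < s) :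
    ∫⁻ x, F x ^ pSub p s ∂ν ≤ (∫⁻ x, ℓ x ^ (-s) ∂ν) ^ (1 / (s + 1)) *
      (∫⁻ x, ℓ x * F x ^ p ∂ν) ^ (s / (s + 1)) := by
  have h := ENNReal.lintegral_mul_norm_pow_le (μ := ν) (f := fun x => ℓ x ^ (-s))
    (g := fun x => ℓ x * F x ^ p) (by fun_prop) (by fun_prop) (p := 1 / (s + 1))
    (q := s / (s + 1)) (by positivity) (by positivity) (by field_simp; ring)
  refine le_of_eq_of_le (lintegral_congr_ae ?_) h
  filter_upwards [hℓ0, hℓt] with x h0 ht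
  rw [ENNReal.mul_rpow_of_nonneg _ _ (by positivity), ← ENNReal.rpow_mul, ← ENNReal.rpow_mul,
    ← mul_assoc, ← ENNReal.rpow_add _ _ h0 ht]
  have : -s * (1 / (s + 1)) + s / (s + 1) = 0 := by ring
  rw [this, ENNReal.rpow_zero, one_mul, pSub, mul_div_assoc]

/-- Hölder with the conjugate exponents `q/(q-p)` and `q/p`. For `q = p` the first is infinite and
the essential supremum is used. -/
theorem lintegral_enorm_mul_rpow_le {L : α → ℝ} (hL : AEMeasurable L ν) {W : α → ℝ≥0∞}
    (hW : AEMeasurable W ν) {p q : ℝ} (hp : 0 < p) (hpq : p ≤ q) :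
    ∫⁻ x, ‖L x‖ₑ * W x ^ p ∂ν ≤
      eLpNorm L (weightExponent p q) ν * (∫⁻ x, W x ^ q ∂ν) ^ (p / q) := by
  rcases hpq.eq_or_lt with rfl | hlt
  · have he : weightExponent p p = ⊤ := by
      simp [weightExponent, ENNReal.div_zero, hp]
    rw [he, eLpNorm_exponent_top, div_self hp.ne', ENNReal.rpow_one,
      ← lintegral_const_mul'' _ (hW.pow_const p)]
    refine lintegral_mono_ae ?_
    filter_upwards [enorm_ae_le_eLpNormEssSup L ν] with x hx
    gcongr
  · have hq : 0 < q := hp.trans hlt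
    have hqp : 0 < q - p := by linarith
    have he : weightExponent p q = ENNReal.ofReal (q / (q - p)) := by
      rw [weightExponent, ENNReal.ofReal_div_of_pos hqp]
    have he0 : 0 < q / (q - p) := by positivity
    have h := ENNReal.lintegral_mul_norm_pow_le (μ := ν) (f := fun x => ‖L x‖ₑ ^ (q / (q - p)))
      (g := fun x => W x ^ q) (by fun_prop) (by fun_prop) (p := (q - p) / q)
      (q := p / q) (by positivity) (by positivity) (by field_simp; ring)
    rw [he, eLpNorm_eq_lintegral_rpow_enorm_toReal (by simpa using he0) ENNReal.ofReal_ne_top,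
      ENNReal.toReal_ofReal he0.le, one_div_div]
    refine le_of_eq_of_le (lintegral_congr fun x => ?_) h
    rw [← ENNReal.rpow_mul, ← ENNReal.rpow_mul, div_mul_div_cancel₀ hqp.ne', div_self hq.ne',
      ENNReal.rpow_one, mul_div_cancel₀ _ hq.ne']

theorem lintegral_mul_add_rpow_le {ℓ f g h : α → ℝ≥0∞} (hℓ : AEMeasurable ℓ ν)
    (hf : AEMeasurable f ν) (hle : ∀ᵐ x ∂ν, h x ≤ f x + g x) {p : ℝ} (hp : 1 ≤ p) :
    ∫⁻ x, ℓ x * h x ^ p ∂ν ≤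
      2 ^ (p - 1) * (∫⁻ x, ℓ x * f x ^ p ∂ν + ∫⁻ x, ℓ x * g x ^ p ∂ν) := by
  have h2t : (2 : ℝ≥0∞) ^ (p - 1) ≠ ⊤ := ENNReal.rpow_ne_top_of_nonneg (by linarith) (by simp)
  rw [← lintegral_add_left' (by fun_prop), ← lintegral_const_mul' _ _ h2t]
  refine lintegral_mono_ae ?_
  filter_upwards [hle] with x hx
  calc ℓ x * h x ^ p ≤ ℓ x * (2 ^ (p - 1) * (f x ^ p + g x ^ p)) := by
        gcongr
        exact (ENNReal.rpow_le_rpow hx (by linarith)).trans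
          (ENNReal.rpow_add_le_mul_rpow_add_rpow _ _ hp)
    _ = _ := by ring

theorem lintegral_add_rpow_le {f g h : α → ℝ≥0∞}
    (hf : AEMeasurable f ν) (hle : ∀ᵐ x ∂ν, h x ≤ f x + g x) {p : ℝ} (hp : 1 ≤ p) :
    ∫⁻ x, h x ^ p ∂ν ≤ 2 ^ (p - 1) * (∫⁻ x, f x ^ p ∂ν + ∫⁻ x, g x ^ p ∂ν) := by
  simpa using lintegral_mul_add_rpow_le (ℓ := fun _ => 1) aemeasurable_const hf hle hp

theorem enorm_sub_le_add_sub {F : Type*} [NormedAddCommGroup F] (a b c : F) :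
    ‖a - b‖ₑ ≤ ‖a - c‖ₑ + ‖b - c‖ₑ := by
  calc ‖a - b‖ₑ = ‖(a - c) - (b - c)‖ₑ := by congr 1; abel
    _ ≤ _ := enorm_sub_le

end Weighted

variable {N : ℕ}

/-- `L` is measurable, positive a.e. and locally integrable in `Ω`. -/
structure IsWeight (Ω : Set (EuclideanSpace ℝ (Fin N))) (L : EuclideanSpace ℝ (Fin N) → ℝ) :
    Prop where
  aemeasurable : AEMeasurable L (volume.restrict Ω)
  pos : ∀ᵐ x ∂volume.restrict Ω, 0 < L x
  locallyIntegrable : LocallyIntegrableOn L Ω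

theorem enorm_fderiv_eq_enorm_gradient (f : EuclideanSpace ℝ (Fin N) → ℝ)
    (x : EuclideanSpace ℝ (Fin N)) : ‖fderiv ℝ f x‖ₑ = ‖gradient f x‖ₑ := by
  rw [← ofReal_norm, ← ofReal_norm, gradient, LinearIsometryEquiv.norm_map]

theorem gradient_sub {f g : EuclideanSpace ℝ (Fin N) → ℝ} {x : EuclideanSpace ℝ (Fin N)}
    (hf : DifferentiableAt ℝ f x) (hg : DifferentiableAt ℝ g x) :
    gradient (fun y => f y - g y) x = gradient f x - gradient g x := by
  rw [gradient, fderiv_fun_sub hf hg, map_sub]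
  rfl

theorem _root_.ContDiff.continuous_gradient {f : EuclideanSpace ℝ (Fin N) → ℝ}
    (hf : ContDiff ℝ 1 f) : Continuous (gradient f) :=
  (LinearIsometryEquiv.continuous _).comp (hf.continuous_fderiv one_ne_zero)

theorem tsupport_gradient_subset (f : EuclideanSpace ℝ (Fin N) → ℝ) :
    tsupport (gradient f) ⊆ tsupport f := by
  refine closure_minimal (fun x hx => ?_) (isClosed_tsupport f)
  refine support_fderiv_subset ℝ (f := f) fun h => hx ?_
  simp [gradient, h]

theorem IsCc1.lintegral_gradient_lt_top {Ω : Set (EuclideanSpace ℝ (Fin N))}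
    {L : EuclideanSpace ℝ (Fin N) → ℝ} (hL : IsWeight Ω L) {p : ℝ} (hp : 1 < p)
    {φ : EuclideanSpace ℝ (Fin N) → ℝ} (hφ : IsCc1 Ω φ) :
    ∫⁻ x in Ω, ENNReal.ofReal (L x * ‖gradient φ x‖ ^ p) < ⊤ := by
  have hc := hφ.1.continuous_gradient
  have hcs : HasCompactSupport (gradient φ) :=
    hφ.2.1.of_isClosed_subset (isClosed_tsupport _) (tsupport_gradient_subset φ)
  obtain ⟨c, hc'⟩ := hc.bounded_above_of_compact_support hcs
  have hint : IntegrableOn L (tsupport φ) :=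
    hL.locallyIntegrable.integrableOn_compact_subset hφ.2.2 hφ.2.1
  have hK : MeasurableSet (tsupport φ) := (isClosed_tsupport φ).measurableSet
  calc _ ≤ ∫⁻ x in Ω, (tsupport φ).indicator
        (fun x => ‖L x‖ₑ * ENNReal.ofReal (c ^ p)) x := by
        refine lintegral_mono fun x => ?_
        by_cases hx : x ∈ tsupport φ
        · rw [indicator_of_mem hx, ENNReal.ofReal_mul' (by positivity)]
          refine mul_le_mul' (Real.ofReal_le_enorm _) (ENNReal.ofReal_le_ofReal ?_)
          gcongr
          exact hc' x
        · have : gradient φ x = 0 := by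
            by_contra h
            exact hx (tsupport_gradient_subset φ (subset_tsupport _ h))
          simp [this, Real.zero_rpow (by linarith : p ≠ 0)]
    _ ≤ ∫⁻ x in tsupport φ, ‖L x‖ₑ * ENNReal.ofReal (c ^ p) := by
        refine (setLIntegral_le_lintegral _ _).trans ?_
        rw [lintegral_indicator hK]
    _ < ⊤ := by
        rw [lintegral_mul_const' _ _ ENNReal.ofReal_ne_top]
        exact ENNReal.mul_lt_top hint.2 ENNReal.ofReal_lt_top

theorem MemD.lintegral_gradient_lt_top {Ω : Set (EuclideanSpace ℝ (Fin N))}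
    {L : EuclideanSpace ℝ (Fin N) → ℝ} (hL : IsWeight Ω L) {p : ℝ} (hp : 1 < p)
    {u : EuclideanSpace ℝ (Fin N) → ℝ} {G : EuclideanSpace ℝ (Fin N) → EuclideanSpace ℝ (Fin N)}
    (hu : MemD p Ω L u G) : ∫⁻ x in Ω, ENNReal.ofReal (L x * ‖G x‖ ^ p) < ⊤ := by
  obtain ⟨-, hG, φ, hφ, -, hlim⟩ := hu
  obtain ⟨n, hn⟩ := (hlim.eventually_lt_const ENNReal.zero_lt_top).exists
  have h2t : (2 : ℝ≥0∞) ^ (p - 1) ≠ ⊤ := ENNReal.rpow_ne_top_of_nonneg (by linarith) (by simp)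
  have hm := hL.aemeasurable
  have h := lintegral_mul_add_rpow_le (ν := volume.restrict Ω) (ℓ := fun x => ENNReal.ofReal (L x))
    (f := fun x => ‖gradient (φ n) x‖ₑ) (g := fun x => ‖gradient (φ n) x - G x‖ₑ)
    (h := fun x => ‖G x‖ₑ) (by fun_prop)
    ((hφ n).1.continuous_gradient.enorm.measurable.aemeasurable)
    (ae_of_all _ fun x => by
      calc ‖G x‖ₑ = ‖gradient (φ n) x - (gradient (φ n) x - G x)‖ₑ := by simp
        _ ≤ _ := enorm_sub_le) hp.le
  simp_rw [← ofReal_mul_norm_rpow _ _ (show 0 ≤ p by linarith)] at h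
  exact h.trans_lt (ENNReal.mul_lt_top h2t.lt_top
    (ENNReal.add_lt_top.2 ⟨(hφ n).lintegral_gradient_lt_top hL hp, hn⟩))

end

/-! ### Improved convergence of the approximating sequence -/

section

section Weighted

variable {α : Type*} [MeasurableSpace α] {ν : Measure α}

/-- Convergence in `L^τ` yields a subsequence which converges a.e. -/
theorem exists_seq_tendsto_ae_of_tendsto_lintegral {f : ℕ → α → ℝ} {g : α → ℝ} {τ : ℝ} (hτ : 0 < τ)
    (hf : ∀ n, AEStronglyMeasurable (f n) ν) (hg : AEStronglyMeasurable g ν)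
    (h : Tendsto (fun n => ∫⁻ x, ‖f n x - g x‖ₑ ^ τ ∂ν) atTop (𝓝 0)) :
    ∃ ns : ℕ → ℕ, StrictMono ns ∧
      ∀ᵐ x ∂ν, Tendsto (fun i => f (ns i) x) atTop (𝓝 (g x)) := by
  refine (tendstoInMeasure_of_tendsto_eLpNorm (p := ENNReal.ofReal τ) (by simpa using hτ) hf hg
    ?_).exists_seq_tendsto_ae
  simp_rw [eLpNorm_eq_lintegral_rpow_enorm_toReal (p := ENNReal.ofReal τ)
    (by simpa using hτ) ENNReal.ofReal_ne_top, ENNReal.toReal_ofReal hτ.le]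
  exact tendsto_rpow_nhds_zero h (by positivity)

/-- Fatou's lemma, in the form in which every estimate for smooth or truncated functions is passed
to the limit. -/
theorem lintegral_rpow_le_of_tendsto {f : ℕ → α → ℝ} {g : α → ℝ} {τ : ℝ}
    (hf : ∀ n, AEStronglyMeasurable (f n) ν)
    (hlim : ∀ᵐ x ∂ν, Tendsto (fun i => f i x) atTop (𝓝 (g x))) {b : ℕ → ℝ≥0∞} {b₀ : ℝ≥0∞}
    (hle : ∀ n, ∫⁻ x, ‖f n x‖ₑ ^ τ ∂ν ≤ b n) (hb : Tendsto b atTop (𝓝 b₀)) :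
    ∫⁻ x, ‖g x‖ₑ ^ τ ∂ν ≤ b₀ := by
  calc _ = ∫⁻ x, liminf (fun n => ‖f n x‖ₑ ^ τ) atTop ∂ν := by
        refine lintegral_congr_ae ?_
        filter_upwards [hlim] with x hx
        exact (((ENNReal.continuous_rpow_const (y := τ)).tendsto _).comp hx.enorm).liminf_eq.symm
    _ ≤ liminf (fun n => ∫⁻ x, ‖f n x‖ₑ ^ τ ∂ν) atTop :=
        lintegral_liminf_le' fun n => (hf n).enorm.pow_const τ
    _ ≤ liminf b atTop := liminf_le_liminf (Eventually.of_forall hle)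
    _ = b₀ := hb.liminf_eq

end Weighted

variable {N : ℕ}

theorem IsWeight.lintegral_sub_rpow_pSub_le {Ω : Set (EuclideanSpace ℝ (Fin N))}
    {L : EuclideanSpace ℝ (Fin N) → ℝ} (hL : IsWeight Ω L) {p s : ℝ} (hp : 1 < p) (hs : 0 < s)
    {B : Set (EuclideanSpace ℝ (Fin N))} (hB : B ⊆ Ω)
    {F : EuclideanSpace ℝ (Fin N) → EuclideanSpace ℝ (Fin N)}
    (hF : AEStronglyMeasurable F (volume.restrict B)) :
    ∫⁻ x in B, ‖F x‖ₑ ^ pSub p s ≤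
      (∫⁻ x in B, ENNReal.ofReal (L x) ^ (-s)) ^ (1 / (s + 1)) *
        (∫⁻ x in B, ENNReal.ofReal (L x * ‖F x‖ ^ p)) ^ (s / (s + 1)) := by
  have hm := hL.aemeasurable.mono_measure (Measure.restrict_mono hB le_rfl)
  have hpos := ae_mono (Measure.restrict_mono hB le_rfl) hL.pos
  simp_rw [ofReal_mul_norm_rpow _ _ (show 0 ≤ p by linarith)]
  refine lintegral_rpow_pSub_le hm.ennreal_ofReal hF.enorm ?_ (by simp) hs
  filter_upwards [hpos] with x hx
  simpa using hx

/-- `φ` is a sequence as in `MemD` for `u` and its gradient `G`, which moreover converges to `u` in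
`L^q(B)` and a.e. in `B`. -/
structure IsApprox (p q : ℝ) (Ω : Set (EuclideanSpace ℝ (Fin N)))
    (L : EuclideanSpace ℝ (Fin N) → ℝ) (B : Set (EuclideanSpace ℝ (Fin N)))
    (u : EuclideanSpace ℝ (Fin N) → ℝ) (G : EuclideanSpace ℝ (Fin N) → EuclideanSpace ℝ (Fin N))
    (φ : ℕ → EuclideanSpace ℝ (Fin N) → ℝ) : Prop where
  aestronglyMeasurable : AEStronglyMeasurable u (volume.restrict Ω)
  aestronglyMeasurable_gradient : AEStronglyMeasurable G (volume.restrict Ω)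
  isCc1 : ∀ n, IsCc1 Ω (φ n)
  tendsto_L1 : ∀ S ⊆ Ω, IsCompact S →
    Tendsto (fun n => ∫⁻ x in S, ENNReal.ofReal |φ n x - u x|) atTop (𝓝 0)
  tendsto_gradient : Tendsto
    (fun n => ∫⁻ x in Ω, ENNReal.ofReal (L x * ‖gradient (φ n) x - G x‖ ^ p)) atTop (𝓝 0)
  tendsto_Lq : Tendsto (fun n => ∫⁻ x in B, ‖φ n x - u x‖ₑ ^ q) atTop (𝓝 0)
  tendsto_ae : ∀ᵐ x ∂volume.restrict B, Tendsto (fun n => φ n x) atTop (𝓝 (u x))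

/-- On a ball where `L^{-s}` is integrable, the approximating sequence converges in `L^q` and, up to
a subsequence, almost everywhere. -/
theorem MemD.exists_isApprox {Ω : Set (EuclideanSpace ℝ (Fin N))}
    {L : EuclideanSpace ℝ (Fin N) → ℝ} (hL : IsWeight Ω L) {p s q : ℝ} (hp : 1 < p) (hs : 0 < s)
    (ha : 1 ≤ pSub p s) (haq : pSub p s ≤ q) (hq : 1 < q)
    (hκ : N * (1 / pSub p s - 1 / q) < 1) {x₀ : EuclideanSpace ℝ (Fin N)} {r : ℝ} (hr : 0 < r)
    (hB : Metric.ball x₀ r ⊆ Ω) (hΛ : ∫⁻ x in Metric.ball x₀ r, ENNReal.ofReal (L x) ^ (-s) ≠ ⊤)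
    {u : EuclideanSpace ℝ (Fin N) → ℝ} {G : EuclideanSpace ℝ (Fin N) → EuclideanSpace ℝ (Fin N)}
    (hu : MemD p Ω L u G) :
    ∃ φ, IsApprox p q Ω L (Metric.ball x₀ r) u G φ := by
  obtain ⟨hum, hGm, φ, hφ, hloc, hlim⟩ := hu
  set B := Metric.ball x₀ r with hBdef
  set a := pSub p s
  have ha0 : 0 < a := by linarith
  have hq0 : 0 < q := by linarith
  have huB : AEStronglyMeasurable u (volume.restrict B) :=
    hum.mono_measure (Measure.restrict_mono hB le_rfl)
  have hGB : AEStronglyMeasurable G (volume.restrict B) :=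
    hGm.mono_measure (Measure.restrict_mono hB le_rfl)
  obtain ⟨C, hC, hpoinc⟩ := exists_lintegral_ball_rpow_le (E := EuclideanSpace ℝ (Fin N)) volume
    ha haq hq (by simpa using hκ) hr
  set α : ℕ → ℝ≥0∞ := fun n => ∫⁻ x in B, ‖gradient (φ n) x - G x‖ₑ ^ a
  set β : ℕ → ℝ≥0∞ := fun n => ∫⁻ x in Metric.ball x₀ (r / 2), ‖φ n x - u x‖ₑ
  have hα : Tendsto α atTop (𝓝 0) := by
    refine tendsto_of_tendsto_of_tendsto_of_le_of_le tendsto_const_nhds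
      (tendsto_const_mul_nhds_zero (tendsto_rpow_nhds_zero hlim (y := s / (s + 1)) (by positivity))
        (c := (∫⁻ x in B, ENNReal.ofReal (L x) ^ (-s)) ^ (1 / (s + 1)))
        (ENNReal.rpow_ne_top_of_nonneg (by positivity) hΛ)) (fun n => zero_le) fun n => ?_
    refine (hL.lintegral_sub_rpow_pSub_le hp hs hB
      ((hφ n).1.continuous_gradient.aestronglyMeasurable.sub hGB)).trans ?_
    exact mul_le_mul_right (ENNReal.rpow_le_rpow (lintegral_mono_set hB) (by positivity)) _
  -- Convergence in `L¹` is known on compact subsets of `Ω` only; this is why the Poincaré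
  -- inequality was stated with the half ball.
  have hβ : Tendsto β atTop (𝓝 0) := by
    have h := hloc (Metric.closedBall x₀ (r / 2))
      ((Metric.closedBall_subset_ball (by linarith)).trans hB) (isCompact_closedBall _ _)
    refine tendsto_of_tendsto_of_tendsto_of_le_of_le tendsto_const_nhds h (fun n => zero_le)
      fun n => ?_
    simp_rw [← Real.enorm_eq_ofReal_abs]
    exact lintegral_mono_set Metric.ball_subset_closedBall
  have hcont : ∀ n, Continuous (φ n) := fun n => (hφ n).1.continuous
  -- The sequence is Cauchy in `L^q(B)`, by the Poincaré inequality for `φ n - φ m`.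
  have hdiff : ∀ n m, ∫⁻ x in B, ‖φ n x - φ m x‖ₑ ^ q ≤
      C * ((2 ^ (a - 1) * (α n + α m)) ^ (q / a) + (β n + β m) ^ q) := fun n m => by
    refine (hpoinc x₀ (fun x => φ n x - φ m x) ((hφ n).1.sub (hφ m).1)).trans ?_
    gcongr
    · refine lintegral_add_rpow_le (((hφ n).1.continuous_gradient.aestronglyMeasurable.sub
        hGB).enorm) (ae_of_all _ fun x => ?_) ha
      rw [enorm_fderiv_eq_enorm_gradient, gradient_sub ((hφ n).1.differentiable one_ne_zero x)
        ((hφ m).1.differentiable one_ne_zero x)]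
      exact enorm_sub_le_add_sub _ _ _
    · have : AEMeasurable (fun x => ‖φ n x - u x‖ₑ)
          (volume.restrict (Metric.ball x₀ (r / 2))) :=
        ((hcont n).aestronglyMeasurable.sub (huB.mono_measure (Measure.restrict_mono
          (Metric.ball_subset_ball (by linarith)) le_rfl))).enorm
      rw [← lintegral_add_left' this]
      exact lintegral_mono fun x => enorm_sub_le_add_sub _ _ _
  set γ : ℕ → ℝ≥0∞ := fun n => C * ((2 ^ (a - 1) * α n) ^ (q / a) + β n ^ q)
  have h2t : (2 : ℝ≥0∞) ^ (a - 1) ≠ ⊤ := ENNReal.rpow_ne_top_of_nonneg (by linarith) (by simp)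
  have hγ : Tendsto γ atTop (𝓝 0) := by
    refine tendsto_const_mul_nhds_zero ?_ hC
    simpa using (tendsto_rpow_nhds_zero (tendsto_const_mul_nhds_zero hα h2t)
      (y := q / a) (by positivity)).add (tendsto_rpow_nhds_zero hβ hq0)
  -- The `L^q` limit is identified with `u`: with `n` fixed, let `m → ∞` in `hdiff` along a
  -- subsequence converging a.e. on a compact ball. The bound `γ n` does not depend on that ball, so
  -- exhausting `B` gives the estimate on all of it.
  have hball : ∀ n, ∀ k : ℕ, ∫⁻ x in Metric.closedBall x₀ (r - r / (k + 1)),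
      ‖φ n x - u x‖ₑ ^ q ≤ γ n := fun n k => by
    have hlt : r - r / (k + 1) < r := by
      have : 0 < r / (k + 1) := by positivity
      linarith
    have hSB : Metric.closedBall x₀ (r - r / (k + 1)) ⊆ B := Metric.closedBall_subset_ball hlt
    have huS := huB.mono_measure (Measure.restrict_mono hSB le_rfl)
    have h := hloc _ (hSB.trans hB) (isCompact_closedBall _ _)
    obtain ⟨ns, hns, hae⟩ := exists_seq_tendsto_ae_of_tendsto_lintegral (τ := 1) one_pos
      (fun n => (hcont n).aestronglyMeasurable) huS
      (by simpa only [ENNReal.rpow_one, Real.enorm_eq_ofReal_abs] using h)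
    have hmain := lintegral_rpow_le_of_tendsto (τ := q)
      (f := fun i x => φ n x - φ (ns i) x) (g := fun x => φ n x - u x)
      (b := fun i => C * ((2 ^ (a - 1) * (α n + α (ns i))) ^ (q / a) + (β n + β (ns i)) ^ q))
      (b₀ := γ n)
      (fun i => ((hcont n).sub (hcont (ns i))).aestronglyMeasurable)
      (by filter_upwards [hae] with x hx using hx.const_sub _)
      (fun i => (lintegral_mono_set hSB).trans (hdiff n (ns i))) ?_
    · exact hmain
    · have h1 : Tendsto (fun i => α n + α (ns i)) atTop (𝓝 (α n)) := by
        simpa using (hα.comp hns.tendsto_atTop).const_add (α n)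
      have h2 : Tendsto (fun i => β n + β (ns i)) atTop (𝓝 (β n)) := by
        simpa using (hβ.comp hns.tendsto_atTop).const_add (β n)
      refine ENNReal.Tendsto.const_mul (Tendsto.add ?_ ?_) (.inr hC)
      · exact ((ENNReal.continuous_rpow_const (y := q / a)).tendsto _).comp
          (ENNReal.Tendsto.const_mul h1 (.inr h2t))
      · exact ((ENNReal.continuous_rpow_const (y := q)).tendsto _).comp h2
  have hunion : ⋃ k : ℕ, Metric.closedBall x₀ (r - r / (k + 1)) = B := by
    refine subset_antisymm (iUnion_subset fun k => Metric.closedBall_subset_ball ?_) fun x hx => ?_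
    · have : 0 < r / (k + 1) := by positivity
      linarith
    · rw [hBdef, Metric.mem_ball] at hx
      obtain ⟨k, hk⟩ := exists_nat_gt (r / (r - dist x x₀))
      refine mem_iUnion.2 ⟨k, ?_⟩
      rw [div_lt_iff₀ (by linarith)] at hk
      rw [Metric.mem_closedBall, le_sub_comm, div_le_iff₀ (by positivity)]
      nlinarith [dist_nonneg (x := x) (y := x₀)]
  have hqlim : Tendsto (fun n => ∫⁻ x in B, ‖φ n x - u x‖ₑ ^ q) atTop (𝓝 0) := by
    refine tendsto_of_tendsto_of_tendsto_of_le_of_le tendsto_const_nhds hγ (fun n => zero_le)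
      fun n => ?_
    dsimp only
    rw [← hunion, setLIntegral_iUnion_of_directed]
    · exact iSup_le fun k => hball n k
    · refine Monotone.directed_le fun k l hkl => Metric.closedBall_subset_closedBall ?_
      gcongr
  obtain ⟨ns, hns, hae⟩ := exists_seq_tendsto_ae_of_tendsto_lintegral hq0
    (fun n => (hcont n).aestronglyMeasurable) huB hqlim
  exact ⟨fun i => φ (ns i), hum, hGm, fun i => hφ _, fun S hS hSc =>
    (hloc S hS hSc).comp hns.tendsto_atTop, hlim.comp hns.tendsto_atTop,
    hqlim.comp hns.tendsto_atTop, hae⟩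

theorem IsApprox.lintegral_rpow_lt_top {Ω : Set (EuclideanSpace ℝ (Fin N))} {p q : ℝ} (hq : 1 ≤ q)
    {L : EuclideanSpace ℝ (Fin N) → ℝ} {x₀ : EuclideanSpace ℝ (Fin N)} {r : ℝ}
    {u : EuclideanSpace ℝ (Fin N) → ℝ} {G : EuclideanSpace ℝ (Fin N) → EuclideanSpace ℝ (Fin N)}
    {φ : ℕ → EuclideanSpace ℝ (Fin N) → ℝ}
    (h : IsApprox p q Ω L (Metric.ball x₀ r) u G φ) :
    ∫⁻ x in Metric.ball x₀ r, ‖u x‖ₑ ^ q < ⊤ := by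
  have hφ := h.isCc1
  have hlim := h.tendsto_Lq
  have hq0 : 0 < q := by linarith
  obtain ⟨n, hn⟩ := (hlim.eventually_lt_const ENNReal.zero_lt_top).exists
  have hc := (hφ n).1.continuous
  obtain ⟨c, hc'⟩ := hc.bounded_above_of_compact_support (hφ n).2.1
  have h2t : (2 : ℝ≥0∞) ^ (q - 1) ≠ ⊤ := ENNReal.rpow_ne_top_of_nonneg (by linarith) (by simp)
  have hφq : ∫⁻ x in Metric.ball x₀ r, ‖φ n x‖ₑ ^ q < ⊤ := by
    calc _ ≤ ∫⁻ x in Metric.ball x₀ r, ENNReal.ofReal c ^ q := by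
          refine lintegral_mono fun x => ?_
          gcongr
          rw [← ofReal_norm]
          exact ENNReal.ofReal_le_ofReal (hc' x)
      _ < ⊤ := by
          rw [setLIntegral_const]
          exact ENNReal.mul_lt_top (ENNReal.rpow_lt_top_of_nonneg hq0.le ENNReal.ofReal_ne_top)
            measure_ball_lt_top
  refine (lintegral_add_rpow_le (f := fun x => ‖φ n x‖ₑ) (g := fun x => ‖φ n x - u x‖ₑ)
    hc.enorm.measurable.aemeasurable (ae_of_all _ fun x => ?_) hq).trans_lt
    (ENNReal.mul_lt_top h2t.lt_top (ENNReal.add_lt_top.2 ⟨hφq, hn⟩))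
  calc ‖u x‖ₑ = ‖φ n x - (φ n x - u x)‖ₑ := by simp
    _ ≤ _ := enorm_sub_le

end

/-! ### Chain rule and Sobolev inequality in the energy space -/

section

variable {N : ℕ}

theorem gradient_mul_comp {ζ φ : EuclideanSpace ℝ (Fin N) → ℝ} {Φ : ℝ → ℝ}
    {x : EuclideanSpace ℝ (Fin N)} (hζ : DifferentiableAt ℝ ζ x) (hφ : DifferentiableAt ℝ φ x)
    (hΦ : DifferentiableAt ℝ Φ (φ x)) :
    gradient (fun y => ζ y * Φ (φ y)) x =
      (ζ x * deriv Φ (φ x)) • gradient φ x + Φ (φ x) • gradient ζ x := by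
  have h : HasFDerivAt (fun y => ζ y * Φ (φ y)) _ x := hζ.hasFDerivAt.mul
    (hΦ.hasDerivAt.comp_hasFDerivAt x hφ.hasFDerivAt)
  rw [gradient, h.fderiv, map_add, LinearIsometryEquiv.map_smulₛₗ,
    LinearIsometryEquiv.map_smulₛₗ, LinearIsometryEquiv.map_smulₛₗ, smul_smul]
  rfl

theorem tsupport_mul_subset_left' (ζ g : EuclideanSpace ℝ (Fin N) → ℝ) :
    tsupport (fun x => ζ x * g x) ⊆ tsupport ζ := tsupport_mul_subset_left

theorem gradient_eq_zero_of_notMem_tsupport {ζ : EuclideanSpace ℝ (Fin N) → ℝ}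
    {x : EuclideanSpace ℝ (Fin N)} (hx : x ∉ tsupport ζ) : gradient ζ x = 0 := by
  by_contra h
  exact hx (tsupport_gradient_subset ζ (subset_tsupport _ h))

theorem enorm_comp_sub_le {Φ : ℝ → ℝ} (hΦ : ContDiff ℝ 1 Φ) {D : ℝ} (hD : ∀ t, |deriv Φ t| ≤ D)
    (a b : ℝ) : ‖Φ a - Φ b‖ₑ ≤ ENNReal.ofReal D * ‖a - b‖ₑ := by
  have := Convex.norm_image_sub_le_of_norm_deriv_le (s := univ) (f := Φ) (C := D) (x := b) (y := a)
    (fun x _ => hΦ.differentiable one_ne_zero x) (fun x _ => hD x) convex_univ (mem_univ _)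
    (mem_univ _)
  rw [← ofReal_norm, ← ofReal_norm, ← ENNReal.ofReal_mul ((abs_nonneg _).trans (hD 0))]
  exact ENNReal.ofReal_le_ofReal this

variable {p q : ℝ} {Ω B : Set (EuclideanSpace ℝ (Fin N))}
  {L : EuclideanSpace ℝ (Fin N) → ℝ} {u : EuclideanSpace ℝ (Fin N) → ℝ}
  {G : EuclideanSpace ℝ (Fin N) → EuclideanSpace ℝ (Fin N)}
  {φ : ℕ → EuclideanSpace ℝ (Fin N) → ℝ}

/-- The gradients of `ζ Φ(φₙ)` converge in the weighted `L^p` space. -/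
theorem IsApprox.tendsto_gradient_mul_comp (h : IsApprox p q Ω L B u G φ) (hp : 1 < p)
    (hpq : p ≤ q) (hL : IsWeight Ω L) (hBm : MeasurableSet B) (hB : B ⊆ Ω)
    (hLB : eLpNorm L (weightExponent p q) (volume.restrict B) ≠ ⊤)
    (hG : ∫⁻ x in Ω, ENNReal.ofReal (L x * ‖G x‖ ^ p) ≠ ⊤)
    {ζ : EuclideanSpace ℝ (Fin N) → ℝ} (hζ : ContDiff ℝ 1 ζ) (hζc : HasCompactSupport ζ)
    (hζB : tsupport ζ ⊆ B) {Φ : ℝ → ℝ} (hΦ : ContDiff ℝ 1 Φ) {D : ℝ}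
    (hD : ∀ t, |deriv Φ t| ≤ D) :
    Tendsto (fun n => ∫⁻ x in Ω, ENNReal.ofReal (L x *
      ‖gradient (fun y => ζ y * Φ (φ n y)) x -
        ((ζ x * deriv Φ (u x)) • G x + Φ (u x) • gradient ζ x)‖ ^ p)) atTop (𝓝 0) := by
  have hp0 : 0 < p := by linarith
  have hq0 : 0 < q := by linarith
  have hle := Measure.restrict_mono hB (le_refl (volume : Measure (EuclideanSpace ℝ (Fin N))))
  have hu := h.aestronglyMeasurable.mono_measure hle
  have hGm := h.aestronglyMeasurable_gradient.mono_measure hle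
  have hLm := hL.aemeasurable.mono_measure hle
  have hcont : ∀ n, Continuous (φ n) := fun n => (h.isCc1 n).1.continuous
  have hgrad : ∀ n, Continuous (gradient (φ n)) := fun n => (h.isCc1 n).1.continuous_gradient
  have hΦ' : Continuous (deriv Φ) := hΦ.continuous_deriv_one
  have hgζ := hζ.continuous_gradient
  obtain ⟨Z, hZ⟩ := hζ.continuous.bounded_above_of_compact_support hζc
  obtain ⟨Z', hZ'⟩ := hgζ.bounded_above_of_compact_support
    (hζc.of_isClosed_subset (isClosed_tsupport _) (tsupport_gradient_subset ζ))
  set z := ENNReal.ofReal Z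
  set z' := ENNReal.ofReal Z'
  set δ := ENNReal.ofReal D
  have hz : ∀ x, ‖ζ x‖ₑ ≤ z := fun x => by
    rw [← ofReal_norm]; exact ENNReal.ofReal_le_ofReal (hZ x)
  have hz' : ∀ x, ‖gradient ζ x‖ₑ ≤ z' := fun x => by
    rw [← ofReal_norm]; exact ENNReal.ofReal_le_ofReal (hZ' x)
  have hδ : ∀ t, ‖deriv Φ t‖ₑ ≤ δ := fun t => by
    rw [Real.enorm_eq_ofReal_abs]; exact ENNReal.ofReal_le_ofReal (hD t)
  -- The error in the gradient has three parts: `T₁` from the gradients of `φ n`, `T₂` from `Φ'(φ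
  -- n)`, `T₃` from `Φ(φ n)`. They tend to zero by energy convergence, by dominated convergence, and
  -- by `L^q` convergence with Hölder for `L`, respectively.
  set T₁ : ℕ → EuclideanSpace ℝ (Fin N) → ℝ≥0∞ := fun n x => z * δ * ‖gradient (φ n) x - G x‖ₑ
  set T₂ : ℕ → EuclideanSpace ℝ (Fin N) → ℝ≥0∞ := fun n x =>
    z * (‖deriv Φ (φ n x) - deriv Φ (u x)‖ₑ * ‖G x‖ₑ)
  set T₃ : ℕ → EuclideanSpace ℝ (Fin N) → ℝ≥0∞ := fun n x => δ * z' * ‖φ n x - u x‖ₑ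
  set ℓ : EuclideanSpace ℝ (Fin N) → ℝ≥0∞ := fun x => ENNReal.ofReal (L x)
  have hℓ : AEMeasurable ℓ (volume.restrict B) := hLm.ennreal_ofReal
  have hpt : ∀ n x, ‖gradient (fun y => ζ y * Φ (φ n y)) x -
      ((ζ x * deriv Φ (u x)) • G x + Φ (u x) • gradient ζ x)‖ₑ ≤
      T₁ n x + (T₂ n x + T₃ n x) := fun n x => by
    rw [gradient_mul_comp (hζ.differentiable one_ne_zero x)
      ((h.isCc1 n).1.differentiable one_ne_zero x) (hΦ.differentiable one_ne_zero _)]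
    calc _ = ‖(ζ x * deriv Φ (φ n x)) • (gradient (φ n) x - G x) +
          ((ζ x * (deriv Φ (φ n x) - deriv Φ (u x))) • G x +
            (Φ (φ n x) - Φ (u x)) • gradient ζ x)‖ₑ := by
          congr 1
          module
      _ ≤ _ := (enorm_add_le _ _).trans (add_le_add_right (enorm_add_le _ _) _)
      _ ≤ _ := by
          simp only [enorm_smul, enorm_mul]
          refine add_le_add ?_ (add_le_add ?_ ?_)
          · exact mul_le_mul' (mul_le_mul' (hz x) (hδ _)) le_rfl
          · rw [mul_assoc]
            exact mul_le_mul' (hz x) le_rfl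
          · calc _ ≤ (δ * ‖φ n x - u x‖ₑ) * z' :=
                  mul_le_mul' (enorm_comp_sub_le hΦ hD _ _) (hz' x)
              _ = _ := by simp only [T₃]; ring
  have hzero : ∀ n, ∀ x ∉ B, gradient (fun y => ζ y * Φ (φ n y)) x -
      ((ζ x * deriv Φ (u x)) • G x + Φ (u x) • gradient ζ x) = 0 := fun n x hx => by
    have hxζ : x ∉ tsupport ζ := fun hh => hx (hζB hh)
    rw [gradient_eq_zero_of_notMem_tsupport
        (fun hh => hxζ (tsupport_mul_subset_left' ζ (fun y => Φ (φ n y)) hh)),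
      gradient_eq_zero_of_notMem_tsupport hxζ, image_eq_zero_of_notMem_tsupport hxζ]
    simp
  have hbound : ∀ n, ∫⁻ x in Ω, ENNReal.ofReal (L x *
      ‖gradient (fun y => ζ y * Φ (φ n y)) x -
        ((ζ x * deriv Φ (u x)) • G x + Φ (u x) • gradient ζ x)‖ ^ p) ≤
      2 ^ (p - 1) * ((∫⁻ x in B, ℓ x * T₁ n x ^ p) +
        2 ^ (p - 1) * ((∫⁻ x in B, ℓ x * T₂ n x ^ p) + ∫⁻ x in B, ℓ x * T₃ n x ^ p)) := fun n => by
    have hT₁ : AEMeasurable (T₁ n) (volume.restrict B) :=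
      (((hgrad n).aestronglyMeasurable.sub hGm).enorm).const_mul _
    have hT₂ : AEMeasurable (T₂ n) (volume.restrict B) :=
      (((((hΦ'.comp (hcont n)).aestronglyMeasurable.sub
        (hΦ'.comp_aestronglyMeasurable hu)).enorm).mul hGm.enorm)).const_mul _
    calc _ ≤ ∫⁻ x in Ω, B.indicator (fun x => ENNReal.ofReal (L x) *
          ‖gradient (fun y => ζ y * Φ (φ n y)) x -
          ((ζ x * deriv Φ (u x)) • G x + Φ (u x) • gradient ζ x)‖ₑ ^ p) x := by
          refine lintegral_mono fun x => ?_
          by_cases hx : x ∈ B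
          · rw [indicator_of_mem hx, ofReal_mul_norm_rpow _ _ hp0.le]
          · rw [hzero n x hx, norm_zero, Real.zero_rpow hp0.ne', mul_zero, ENNReal.ofReal_zero]
            exact zero_le
      _ ≤ _ := by
          refine (setLIntegral_le_lintegral _ _).trans ?_
          rw [lintegral_indicator hBm]
          refine (lintegral_mul_add_rpow_le hℓ hT₁ (ae_of_all _ fun x => hpt n x) hp.le).trans ?_
          gcongr
          exact lintegral_mul_add_rpow_le hℓ hT₂ (ae_of_all _ fun x => le_rfl) hp.le
  have h2t : (2 : ℝ≥0∞) ^ (p - 1) ≠ ⊤ := ENNReal.rpow_ne_top_of_nonneg (by linarith) (by simp)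
  have hT₁lim : Tendsto (fun n => ∫⁻ x in B, ℓ x * T₁ n x ^ p) atTop (𝓝 0) := by
    have hc : (z * δ) ^ p ≠ ⊤ := ENNReal.rpow_ne_top_of_nonneg hp0.le
      (ENNReal.mul_ne_top ENNReal.ofReal_ne_top ENNReal.ofReal_ne_top)
    refine tendsto_of_tendsto_of_tendsto_of_le_of_le tendsto_const_nhds
      (tendsto_const_mul_nhds_zero h.tendsto_gradient hc) (fun n => zero_le) fun n => ?_
    dsimp only
    rw [← lintegral_const_mul' _ _ hc]
    refine (lintegral_mono_set hB).trans (lintegral_mono fun x => ?_)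
    dsimp only
    rw [ofReal_mul_norm_rpow _ _ hp0.le, ENNReal.mul_rpow_of_nonneg _ _ hp0.le, mul_left_comm]
  have hT₃lim : Tendsto (fun n => ∫⁻ x in B, ℓ x * T₃ n x ^ p) atTop (𝓝 0) := by
    have hc : (δ * z') ^ p ≠ ⊤ := ENNReal.rpow_ne_top_of_nonneg hp0.le
      (ENNReal.mul_ne_top ENNReal.ofReal_ne_top ENNReal.ofReal_ne_top)
    refine tendsto_of_tendsto_of_tendsto_of_le_of_le tendsto_const_nhds
      (tendsto_const_mul_nhds_zero (tendsto_const_mul_nhds_zero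
        (tendsto_rpow_nhds_zero h.tendsto_Lq (y := p / q) (by positivity)) hLB) hc)
      (fun n => zero_le) fun n => ?_
    dsimp only
    calc _ ≤ ∫⁻ x in B, (δ * z') ^ p * (‖L x‖ₑ * ‖φ n x - u x‖ₑ ^ p) := by
          refine lintegral_mono fun x => ?_
          dsimp only
          rw [ENNReal.mul_rpow_of_nonneg _ _ hp0.le, mul_left_comm]
          gcongr
          exact Real.ofReal_le_enorm _
      _ ≤ _ := by
          rw [lintegral_const_mul' _ _ hc]
          gcongr
          exact lintegral_enorm_mul_rpow_le hLm
            ((hcont n).aestronglyMeasurable.sub hu).enorm hp0 hpq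
  -- Since `Φ'` is merely continuous and bounded, no rate is available; a.e. convergence of `φ n`
  -- and the majorant given by the energy density of `u` are used.
  have hT₂lim : Tendsto (fun n => ∫⁻ x in B, ℓ x * T₂ n x ^ p) atTop (𝓝 0) := by
    have hc : (z * (δ + δ)) ^ p ≠ ⊤ := ENNReal.rpow_ne_top_of_nonneg hp0.le (by finiteness)
    have := tendsto_lintegral_of_dominated_convergence' (μ := volume.restrict B)
      (F := fun n x => ℓ x * T₂ n x ^ p) (f := fun _ => 0)
      (fun x => (z * (δ + δ)) ^ p * ENNReal.ofReal (L x * ‖G x‖ ^ p)) (fun n => ?_) (fun n => ?_)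
      ?_ ?_
    · simpa using this
    · exact hℓ.mul ((((((hΦ'.comp (hcont n)).aestronglyMeasurable.sub
        (hΦ'.comp_aestronglyMeasurable hu)).enorm).mul hGm.enorm)).const_mul _ |>.pow_const p)
    · refine ae_of_all _ fun x => ?_
      simp only [T₂]
      rw [ofReal_mul_norm_rpow _ _ hp0.le, mul_left_comm ((z * (δ + δ)) ^ p),
        ← ENNReal.mul_rpow_of_nonneg _ _ hp0.le, ← mul_assoc]
      refine mul_le_mul_right (ENNReal.rpow_le_rpow (mul_le_mul_left (mul_le_mul_right ?_ z) _)
        hp0.le) _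
      exact enorm_sub_le.trans (add_le_add (hδ _) (hδ _))
    · rw [lintegral_const_mul' _ _ hc]
      exact ENNReal.mul_ne_top hc ((lintegral_mono_set hB).trans_lt hG.lt_top).ne
    · filter_upwards [h.tendsto_ae] with x hx
      have h1 : Tendsto (fun n => ‖deriv Φ (φ n x) - deriv Φ (u x)‖ₑ) atTop (𝓝 0) := by
        have := (((hΦ'.tendsto _).comp hx).sub_const (deriv Φ (u x))).enorm
        simpa using this
      have h2 : Tendsto (fun n => ‖deriv Φ (φ n x) - deriv Φ (u x)‖ₑ * ‖G x‖ₑ) atTop (𝓝 0) := by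
        simpa using ENNReal.Tendsto.mul_const h1 (.inr enorm_ne_top)
      exact tendsto_const_mul_nhds_zero (tendsto_rpow_nhds_zero
        (tendsto_const_mul_nhds_zero h2 ENNReal.ofReal_ne_top) hp0) ENNReal.ofReal_ne_top
  refine tendsto_of_tendsto_of_tendsto_of_le_of_le tendsto_const_nhds ?_ (fun n => zero_le) hbound
  refine tendsto_const_mul_nhds_zero ?_ h2t
  have := hT₁lim.add (tendsto_const_mul_nhds_zero
    (by simpa using hT₂lim.add hT₃lim : Tendsto (fun n => (∫⁻ x in B, ℓ x * T₂ n x ^ p) +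
      ∫⁻ x in B, ℓ x * T₃ n x ^ p) atTop (𝓝 0)) h2t)
  simpa using this

theorem IsCc1.mul_comp {ψ : EuclideanSpace ℝ (Fin N) → ℝ} (hψ : IsCc1 Ω ψ) (hB : B ⊆ Ω)
    {ζ : EuclideanSpace ℝ (Fin N) → ℝ} (hζ : ContDiff ℝ 1 ζ) (hζc : HasCompactSupport ζ)
    (hζB : tsupport ζ ⊆ B) {Φ : ℝ → ℝ} (hΦ : ContDiff ℝ 1 Φ) :
    IsCc1 Ω fun x => ζ x * Φ (ψ x) :=
  ⟨hζ.mul (hΦ.comp hψ.1), hζc.mul_right, (tsupport_mul_subset_left' _ _).trans (hζB.trans hB)⟩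

/-- The functions `ζ Φ(u)` belong to the space `𝒟₀^{1,p}(Ω; L)`. -/
theorem IsApprox.memD_mul_comp (h : IsApprox p q Ω L B u G φ) (hp : 1 < p)
    (hpq : p ≤ q) (hL : IsWeight Ω L) (hBm : MeasurableSet B) (hB : B ⊆ Ω)
    (hLB : eLpNorm L (weightExponent p q) (volume.restrict B) ≠ ⊤)
    (hG : ∫⁻ x in Ω, ENNReal.ofReal (L x * ‖G x‖ ^ p) ≠ ⊤)
    {ζ : EuclideanSpace ℝ (Fin N) → ℝ} (hζ : ContDiff ℝ 1 ζ) (hζc : HasCompactSupport ζ)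
    (hζB : tsupport ζ ⊆ B) {Φ : ℝ → ℝ} (hΦ : ContDiff ℝ 1 Φ) {D : ℝ}
    (hD : ∀ t, |deriv Φ t| ≤ D) :
    MemD p Ω L (fun x => ζ x * Φ (u x))
      (fun x => (ζ x * deriv Φ (u x)) • G x + Φ (u x) • gradient ζ x) := by
  have hΦ' : Continuous (deriv Φ) := hΦ.continuous_deriv_one
  have hu := h.aestronglyMeasurable
  have hG' := h.aestronglyMeasurable_gradient
  have hζm := hζ.continuous.aestronglyMeasurable (μ := volume.restrict Ω)
  refine ⟨hζm.mul (hΦ.continuous.comp_aestronglyMeasurable hu),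
    ((hζm.mul (hΦ'.comp_aestronglyMeasurable hu)).smul hG').add
      ((hΦ.continuous.comp_aestronglyMeasurable hu).smul
        hζ.continuous_gradient.aestronglyMeasurable),
    fun n x => ζ x * Φ (φ n x), fun n => (h.isCc1 n).mul_comp hB hζ hζc hζB hΦ, fun S _ _ => ?_,
    h.tendsto_gradient_mul_comp hp hpq hL hBm hB hLB hG hζ hζc hζB hΦ hD⟩
  obtain ⟨Z, hZ⟩ := hζ.continuous.bounded_above_of_compact_support hζc
  have hlim := h.tendsto_L1 (tsupport ζ) (hζB.trans hB) hζc
  refine tendsto_of_tendsto_of_tendsto_of_le_of_le tendsto_const_nhds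
    (tendsto_const_mul_nhds_zero hlim (c := ENNReal.ofReal Z * ENNReal.ofReal D) (by finiteness))
    (fun n => zero_le) fun n => ?_
  dsimp only
  rw [← lintegral_const_mul' _ _ (by finiteness),
    ← lintegral_indicator (isClosed_tsupport ζ).measurableSet]
  refine (setLIntegral_le_lintegral _ _).trans (lintegral_mono fun x => ?_)
  dsimp only
  by_cases hx : x ∈ tsupport ζ
  · rw [indicator_of_mem hx, ← mul_sub, abs_mul, ENNReal.ofReal_mul (abs_nonneg _), mul_assoc]
    refine mul_le_mul' (ENNReal.ofReal_le_ofReal (hZ x)) ?_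
    rw [← Real.enorm_eq_ofReal_abs, ← Real.enorm_eq_ofReal_abs]
    exact enorm_comp_sub_le hΦ hD _ _
  · simp [image_eq_zero_of_notMem_tsupport hx]

/-- The Sobolev inequality for the functions `ζ Φ(u)`. -/
theorem IsApprox.lintegral_mul_comp_rpow_le (h : IsApprox p q Ω L B u G φ) (hp : 1 < p)
    (hpq : p ≤ q) (hL : IsWeight Ω L) (hBm : MeasurableSet B) (hB : B ⊆ Ω)
    (hLB : eLpNorm L (weightExponent p q) (volume.restrict B) ≠ ⊤)
    (hG : ∫⁻ x in Ω, ENNReal.ofReal (L x * ‖G x‖ ^ p) ≠ ⊤)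
    {ζ : EuclideanSpace ℝ (Fin N) → ℝ} (hζ : ContDiff ℝ 1 ζ) (hζc : HasCompactSupport ζ)
    (hζB : tsupport ζ ⊆ B) {Φ : ℝ → ℝ} (hΦ : ContDiff ℝ 1 Φ) {D : ℝ}
    (hD : ∀ t, |deriv Φ t| ≤ D) {s : ℝ} (hs : 0 < s)
    (hΛ : ∫⁻ x in B, ENNReal.ofReal (L x) ^ (-s) ≠ ⊤) {τ : ℝ} (hτ : 0 < τ) {C : ℝ≥0∞}
    (hC : C ≠ ⊤)
    (hsob : ∀ f : EuclideanSpace ℝ (Fin N) → ℝ, ContDiff ℝ 1 f → tsupport f ⊆ B →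
      ∫⁻ x in B, ‖f x‖ₑ ^ τ ≤ C * (∫⁻ x in B, ‖fderiv ℝ f x‖ₑ ^ pSub p s) ^ (τ / pSub p s)) :
    ∫⁻ x in B, ‖ζ x * Φ (u x)‖ₑ ^ τ ≤
      C * ((∫⁻ x in B, ENNReal.ofReal (L x) ^ (-s)) ^ (1 / s) *
        (2 ^ (p - 1) * ∫⁻ x in B, ENNReal.ofReal (L x) *
          ‖(ζ x * deriv Φ (u x)) • G x + Φ (u x) • gradient ζ x‖ₑ ^ p)) ^ (τ / p) := by
  have hp0 : 0 < p := by linarith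
  have hle := Measure.restrict_mono hB (le_refl (volume : Measure (EuclideanSpace ℝ (Fin N))))
  have hLm := hL.aemeasurable.mono_measure hle
  set Λ := ∫⁻ x in B, ENNReal.ofReal (L x) ^ (-s)
  set H := fun x => (ζ x * deriv Φ (u x)) • G x + Φ (u x) • gradient ζ x
  set f : ℕ → EuclideanSpace ℝ (Fin N) → ℝ := fun n x => ζ x * Φ (φ n x)
  set 𝓔 := ∫⁻ x in B, ENNReal.ofReal (L x) * ‖H x‖ₑ ^ p
  set ε : ℕ → ℝ≥0∞ := fun n => ∫⁻ x in Ω, ENNReal.ofReal (L x * ‖gradient (f n) x - H x‖ ^ p)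
  have hε : Tendsto ε atTop (𝓝 0) :=
    h.tendsto_gradient_mul_comp hp hpq hL hBm hB hLB hG hζ hζc hζB hΦ hD
  have hf : ∀ n, IsCc1 Ω (f n) := fun n => (h.isCc1 n).mul_comp hB hζ hζc hζB hΦ
  have h2t : (2 : ℝ≥0∞) ^ (p - 1) ≠ ⊤ := ENNReal.rpow_ne_top_of_nonneg (by linarith) (by simp)
  have ha : 0 < pSub p s := by unfold pSub; positivity
  have hΛt : Λ ^ (1 / s) ≠ ⊤ := ENNReal.rpow_ne_top_of_nonneg (by positivity) hΛ
  have hHm := ((h.memD_mul_comp hp hpq hL hBm hB hLB hG hζ hζc hζB hΦ hD).2.1).mono_measure hle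
  -- Sobolev holds for the smooth functions `ζ Φ(φ n)`. Their energy is at most `2^{p-1}` times the
  -- limiting energy plus a vanishing error, and Fatou handles the left side.
  refine lintegral_rpow_le_of_tendsto (f := f)
    (b := fun n => C * (Λ ^ (1 / s) * (2 ^ (p - 1) * (ε n + 𝓔))) ^ (τ / p))
    (fun n => (hf n).1.continuous.aestronglyMeasurable) ?_ (fun n => ?_) ?_
  · filter_upwards [h.tendsto_ae] with x hx
    exact ((hΦ.continuous.tendsto _).comp hx).const_mul _
  · refine (hsob (f n) (hf n).1 ((tsupport_mul_subset_left' _ _).trans hζB)).trans ?_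
    refine mul_le_mul_right ?_ C
    simp_rw [enorm_fderiv_eq_enorm_gradient]
    have h1 := hL.lintegral_sub_rpow_pSub_le hp hs hB
      ((hf n).1.continuous_gradient.aestronglyMeasurable (μ := volume.restrict B))
    refine (ENNReal.rpow_le_rpow h1 (by positivity)).trans ?_
    rw [ENNReal.mul_rpow_of_nonneg _ _ (by positivity), ENNReal.mul_rpow_of_nonneg _ _
      (by positivity), ← ENNReal.rpow_mul, ← ENNReal.rpow_mul, ← ENNReal.rpow_mul,
      show 1 / (s + 1) * (τ / pSub p s) = 1 / s * (τ / p) by unfold pSub; field_simp,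
      show s / (s + 1) * (τ / pSub p s) = τ / p by unfold pSub; field_simp]
    refine mul_le_mul_right (ENNReal.rpow_le_rpow ?_ (by positivity)) _
    simp_rw [ofReal_mul_norm_rpow _ _ hp0.le]
    refine (lintegral_mul_add_rpow_le hLm.ennreal_ofReal
      (((hf n).1.continuous_gradient.aestronglyMeasurable.sub hHm).enorm) (g := fun x => ‖H x‖ₑ)
      (ae_of_all _ fun x => ?_) hp.le).trans ?_
    · calc ‖gradient (f n) x‖ₑ = ‖(gradient (f n) x - H x) + H x‖ₑ := by simp
        _ ≤ _ := enorm_add_le _ _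
    · gcongr
      simp only [ε, ofReal_mul_norm_rpow _ _ hp0.le]
      exact lintegral_mono_set hB
  · refine ENNReal.Tendsto.const_mul ?_ (.inr hC)
    refine ((ENNReal.continuous_rpow_const (y := τ / p)).tendsto _).comp
      (ENNReal.Tendsto.const_mul (ENNReal.Tendsto.const_mul ?_ (.inr h2t)) (.inr hΛt))
    simpa using hε.add_const 𝓔

end

/-! ### Caccioppoli inequality -/

section

variable {N : ℕ}

/-- A form of Young's inequality. -/
theorem mul_rpow_mul_le_half_add {p x y : ℝ} (hp : 1 < p) (hx : 0 ≤ x) (hy : 0 ≤ y) :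
    p * x ^ (p - 1) * y ≤ 1 / 2 * x ^ p + p * (2 * p) ^ (p - 1) * y ^ p := by
  have hp0 : 0 < p := by linarith
  -- If `x ≥ 2py`, the product is absorbed by `x^p / 2`; otherwise `x` is replaced by `2py`.
  rcases le_or_gt (2 * p * y) x with h | h
  · have h1 : x ^ p = x ^ (p - 1) * x := by
      rcases hx.eq_or_lt with rfl | hx
      · rw [mul_zero, Real.zero_rpow hp0.ne']
      · rw [← Real.rpow_add_one hx.ne', sub_add_cancel]
    have h2 : 0 ≤ p * (2 * p) ^ (p - 1) * y ^ p := by positivity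
    have h3 : 0 ≤ x ^ (p - 1) := by positivity
    rw [h1]
    nlinarith
  · have hy : 0 < y := by
      by_contra h0
      have : y = 0 := by linarith
      subst this
      linarith
    have h1 : y ^ p = y ^ (p - 1) * y := by
      rw [← Real.rpow_add_one hy.ne', sub_add_cancel]
    have h2 : x ^ (p - 1) ≤ (2 * p) ^ (p - 1) * y ^ (p - 1) := by
      rw [← Real.mul_rpow (by positivity) hy.le]
      exact Real.rpow_le_rpow hx h.le (by linarith)
    have h3 : 0 ≤ 1 / 2 * x ^ p := by positivity
    calc p * x ^ (p - 1) * y ≤ p * ((2 * p) ^ (p - 1) * y ^ (p - 1)) * y := by gcongr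
      _ = p * (2 * p) ^ (p - 1) * y ^ p := by rw [h1]; ring
      _ ≤ _ := by linarith

/-- The case `x = 0` matters: for `p < 2` the factor `x^(p-2)` takes a default value at zero, which
the second factor annihilates. Thus points where `u` or its gradient vanishes need no separate
treatment. -/
theorem rpow_sub_two_mul_self {p x : ℝ} (hp : 1 < p) (hx : 0 ≤ x) :
    x ^ (p - 2) * x = x ^ (p - 1) := by
  rcases hx.eq_or_lt with rfl | hx
  · rw [mul_zero, Real.zero_rpow (by linarith)]
  · rw [← Real.rpow_add_one hx.ne']
    congr 1
    ring

theorem rpow_sub_one_mul_self {p x : ℝ} (hp : 1 < p) (hx : 0 ≤ x) :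
    x ^ (p - 1) * x = x ^ p := by
  rcases hx.eq_or_lt with rfl | hx
  · rw [mul_zero, Real.zero_rpow (by linarith)]
  · rw [← Real.rpow_add_one hx.ne', sub_add_cancel]

theorem gradient_rpow {p : ℝ} (hp : 1 < p) {η : EuclideanSpace ℝ (Fin N) → ℝ}
    {x : EuclideanSpace ℝ (Fin N)} (hη : DifferentiableAt ℝ η x) :
    gradient (fun y => η y ^ p) x = (p * η x ^ (p - 1)) • gradient η x := by
  have h := (Real.hasDerivAt_rpow_const (x := η x) (p := p) (.inr hp.le)).comp_hasFDerivAt x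
    hη.hasFDerivAt
  have h' : HasFDerivAt (fun y => η y ^ p) ((p * η x ^ (p - 1)) • fderiv ℝ η x) x := h
  rw [gradient, h'.fderiv, LinearIsometryEquiv.map_smulₛₗ]
  rfl

/-- The diagonal term is exactly `(η d |g|)^p`. The cross term is at most `p X^{p-1} Y` with `X = η
d |g|`, `Y = a d |e|`, because `|Φ| ≤ a d^p` and `d^p = d^{p-1} d`; Young's inequality then leaves
half of the diagonal term. -/
theorem abs_rpow_mul_inner_sub_le {p η d Φ a : ℝ} (hp : 1 < p) (hη : 0 ≤ η) (hd : 0 ≤ d)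
    (hΦ : |Φ| ≤ a * d ^ p) (ha : 0 ≤ a) (g e : EuclideanSpace ℝ (Fin N)) :
    |‖g‖ ^ (p - 2) * inner ℝ g ((η ^ p * d ^ p) • g + Φ • (p * η ^ (p - 1)) • e) -
      (η * d * ‖g‖) ^ p| ≤
      1 / 2 * (η * d * ‖g‖) ^ p + p * (2 * p) ^ (p - 1) * (a * d * ‖e‖) ^ p := by
  have hg := norm_nonneg g
  have he := norm_nonneg e
  have e1 : ‖g‖ ^ (p - 2) * inner ℝ g ((η ^ p * d ^ p) • g + Φ • (p * η ^ (p - 1)) • e) -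
      (η * d * ‖g‖) ^ p = Φ * (p * η ^ (p - 1)) * (‖g‖ ^ (p - 2) * inner ℝ g e) := by
    rw [inner_add_right, real_inner_smul_right, real_inner_smul_right, real_inner_smul_right,
      real_inner_self_eq_norm_sq, Real.mul_rpow (by positivity) hg, Real.mul_rpow hη hd,
      ← rpow_sub_one_mul_self hp hg, ← rpow_sub_two_mul_self hp hg]
    ring
  rw [e1]
  refine le_trans ?_ (mul_rpow_mul_le_half_add hp (x := η * d * ‖g‖) (y := a * d * ‖e‖)
    (by positivity) (by positivity))
  have hin : |‖g‖ ^ (p - 2) * inner ℝ g e| ≤ ‖g‖ ^ (p - 1) * ‖e‖ := by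
    rw [abs_mul, abs_of_nonneg (by positivity), ← rpow_sub_two_mul_self hp hg, mul_assoc]
    gcongr
    exact abs_real_inner_le_norm g e
  calc _ = |Φ| * (p * η ^ (p - 1)) * |‖g‖ ^ (p - 2) * inner ℝ g e| := by
        rw [abs_mul, abs_mul, abs_of_nonneg (a := p * η ^ (p - 1)) (by positivity)]
    _ ≤ a * d ^ p * (p * η ^ (p - 1)) * (‖g‖ ^ (p - 1) * ‖e‖) := by gcongr
    _ = _ := by
      rw [Real.mul_rpow (by positivity) hg, Real.mul_rpow hη hd, ← rpow_sub_one_mul_self hp hd]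
      ring

variable {p q lam : ℝ} {Ω B : Set (EuclideanSpace ℝ (Fin N))}
  {L K : EuclideanSpace ℝ (Fin N) → ℝ} {u : EuclideanSpace ℝ (Fin N) → ℝ}
  {G : EuclideanSpace ℝ (Fin N) → EuclideanSpace ℝ (Fin N)}
  {φ : ℕ → EuclideanSpace ℝ (Fin N) → ℝ}

/-- The Caccioppoli inequality, with the test function `η^p Φ(u)` where `Φ' = d^p`. -/
theorem IsApprox.caccioppoli (h : IsApprox p q Ω L B u G φ) (hp : 1 < p)
    (hpq : p ≤ q) (hL : IsWeight Ω L) (hBm : MeasurableSet B) (hB : B ⊆ Ω)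
    (hLB : eLpNorm L (weightExponent p q) (volume.restrict B) ≠ ⊤)
    (hG : ∫⁻ x in Ω, ENNReal.ofReal (L x * ‖G x‖ ^ p) ≠ ⊤)
    (hweak : ∀ (ψ : EuclideanSpace ℝ (Fin N) → ℝ)
      (H : EuclideanSpace ℝ (Fin N) → EuclideanSpace ℝ (Fin N)), MemD p Ω L ψ H →
      ∫ x in Ω, L x * ‖G x‖ ^ (p - 2) * inner ℝ (G x) (H x) =
        lam * ∫ x in Ω, K x * |u x| ^ (p - 2) * u x * ψ x)
    {η : EuclideanSpace ℝ (Fin N) → ℝ} (hη : ContDiff ℝ 1 η) (hηc : HasCompactSupport η)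
    (hηB : tsupport η ⊆ B) (hη0 : ∀ x, 0 ≤ η x) (hη1 : ∀ x, η x ≤ 1)
    {d Φ : ℝ → ℝ} {D : ℝ} (hd : Continuous d) (hd0 : ∀ t, 0 ≤ d t) (hdD : ∀ t, d t ≤ D)
    (hΦ : ∀ t, HasDerivAt Φ (d t ^ p) t) (hΦle : ∀ t, |Φ t| ≤ |t| * d t ^ p) :
    ∫⁻ x in B, ENNReal.ofReal (L x) * ‖(η x * d (u x)) • G x‖ₑ ^ p ≤
      2 * ENNReal.ofReal (p * (2 * p) ^ (p - 1)) *
        (∫⁻ x in B, ENNReal.ofReal (L x) * (‖u x * d (u x)‖ₑ * ‖gradient η x‖ₑ) ^ p) +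
      2 * ‖lam‖ₑ * ∫⁻ x in B, ‖K x‖ₑ * (‖η x‖ₑ * ‖u x * d (u x)‖ₑ) ^ p := by
  have hp0 : 0 < p := by linarith
  set c := p * (2 * p) ^ (p - 1) with hc
  have hc0 : 0 < c := by positivity
  have hD0 : 0 ≤ D := (hd0 0).trans (hdD 0)
  have hgη := hη.continuous_gradient
  have hdp : Continuous fun t => d t ^ p := hd.rpow_const fun _ => .inr hp0.le
  have hΦderiv : deriv Φ = fun t => d t ^ p := funext fun t => (hΦ t).deriv
  have hΦ1 : ContDiff ℝ 1 Φ := contDiff_one_iff_deriv.2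
    ⟨fun t => (hΦ t).differentiableAt, hΦderiv ▸ hdp⟩
  have hΦD : ∀ t, |deriv Φ t| ≤ D ^ p := fun t => by
    have := hd0 t
    rw [hΦderiv, abs_of_nonneg (by positivity)]
    exact Real.rpow_le_rpow (hd0 t) (hdD t) hp0.le
  set ζ : EuclideanSpace ℝ (Fin N) → ℝ := fun x => η x ^ p with hζdef
  have hζ : ContDiff ℝ 1 ζ := (Real.contDiff_rpow_const_of_le (n := 1) (by simpa using hp.le)).comp hη
  have hζη : tsupport ζ ⊆ tsupport η := closure_mono fun x hx => by
    intro h0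
    exact hx (by simp [hζdef, h0, Real.zero_rpow hp0.ne'])
  have hζc : HasCompactSupport ζ := hηc.of_isClosed_subset (isClosed_tsupport _) hζη
  have hmem := h.memD_mul_comp hp hpq hL hBm hB hLB hG hζ hζc (hζη.trans hηB) hΦ1 hΦD
  have hw := hweak _ _ hmem
  have hum := h.aestronglyMeasurable
  have hGm := h.aestronglyMeasurable_gradient
  have hdu : AEStronglyMeasurable (fun x => d (u x)) (volume.restrict Ω) :=
    hd.comp_aestronglyMeasurable hum
  set H := fun x => (ζ x * deriv Φ (u x)) • G x + Φ (u x) • gradient ζ x with hH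
  set A : EuclideanSpace ℝ (Fin N) → ℝ := fun x => L x * (η x * d (u x) * ‖G x‖) ^ p with hA
  set T : EuclideanSpace ℝ (Fin N) → ℝ := fun x => L x * (|u x| * d (u x) * ‖gradient η x‖) ^ p
    with hT
  set M : EuclideanSpace ℝ (Fin N) → ℝ := fun x => L x * ‖G x‖ ^ (p - 2) * inner ℝ (G x) (H x)
    with hM
  have hAx : ∀ x, ENNReal.ofReal (A x) =
      ENNReal.ofReal (L x) * ‖(η x * d (u x)) • G x‖ₑ ^ p := fun x => by
    rw [← ofReal_mul_norm_rpow _ _ hp0.le, norm_smul, Real.norm_of_nonneg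
      (mul_nonneg (hη0 x) (hd0 _))]
  have hTx : ∀ x, ENNReal.ofReal (T x) =
      ENNReal.ofReal (L x) * (‖u x * d (u x)‖ₑ * ‖gradient η x‖ₑ) ^ p := fun x => by
    rw [← enorm_smul, ← ofReal_mul_norm_rpow _ _ hp0.le, norm_smul, norm_mul,
      Real.norm_of_nonneg (hd0 _), Real.norm_eq_abs]
  -- If this integral is infinite, so is the right-hand side, because its coefficient is positive.
  -- Otherwise `T` is integrable and real integrals can be used.
  by_cases hTt : ∫⁻ x in B, ENNReal.ofReal (T x) = ⊤
  · simp_rw [hTx] at hTt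
    rw [hTt, ENNReal.mul_top (by simpa using hc0)]
    simp
  have hTΩ : ∫⁻ x in Ω, ENNReal.ofReal (T x) ≤ ∫⁻ x in B, ENNReal.ofReal (T x) := by
    rw [← lintegral_indicator hBm]
    refine (lintegral_mono fun x => ?_).trans (setLIntegral_le_lintegral Ω _)
    by_cases hx : x ∈ B
    · rw [indicator_of_mem hx]
    · simp [hT, gradient_eq_zero_of_notMem_tsupport fun hh => hx (hηB hh), hp0.ne']
  have hLm := hL.aemeasurable.aestronglyMeasurable
  have hηm := hη.continuous.aestronglyMeasurable (μ := volume.restrict Ω)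
  have hAm : AEStronglyMeasurable A (volume.restrict Ω) :=
    hLm.mul ((((hηm.mul hdu).mul hGm.norm).aemeasurable.pow_const p).aestronglyMeasurable)
  have hTm : AEStronglyMeasurable T (volume.restrict Ω) :=
    hLm.mul ((((hum.norm.mul hdu).mul
      hgη.norm.aestronglyMeasurable).aemeasurable.pow_const p).aestronglyMeasurable)
  have hMm : AEStronglyMeasurable M (volume.restrict Ω) :=
    (hLm.mul ((hGm.norm.aemeasurable.pow_const (p - 2)).aestronglyMeasurable)).mul
      (hGm.inner hmem.2.1)
  have hAnn : ∀ᵐ x ∂volume.restrict Ω, 0 ≤ A x := by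
    filter_upwards [hL.pos] with x hx
    have := hη0 x
    have := hd0 (u x)
    positivity
  have hTnn : ∀ᵐ x ∂volume.restrict Ω, 0 ≤ T x := by
    filter_upwards [hL.pos] with x hx
    have := hd0 (u x)
    positivity
  -- Consequently `A ≤ 2M + 2cT` pointwise, which is the absorption, and `M` inherits integrability
  -- from `A` and `T`.
  have hpt : ∀ᵐ x ∂volume.restrict Ω, |M x - A x| ≤ 1 / 2 * A x + c * T x := by
    filter_upwards [hL.pos] with x hx
    have hkey := abs_rpow_mul_inner_sub_le hp (hη0 x) (hd0 (u x)) (hΦle (u x)) (abs_nonneg _)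
      (G x) (gradient η x)
    have e : M x - A x = L x * (‖G x‖ ^ (p - 2) * inner ℝ (G x) ((η x ^ p * d (u x) ^ p) • G x +
        Φ (u x) • (p * η x ^ (p - 1)) • gradient η x) - (η x * d (u x) * ‖G x‖) ^ p) := by
      simp only [hM, hA, hH, hΦderiv, hζdef,
        gradient_rpow hp (hη.differentiable one_ne_zero x)]
      ring
    rw [e, abs_mul, abs_of_pos hx]
    calc _ ≤ _ := mul_le_mul_of_nonneg_left hkey hx.le
      _ = _ := by simp only [hA, hT]; ring
  -- Boundedness of `d` is essential here: it bounds `A` by a multiple of the finite energy density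
  -- of `u`.
  have hAi : Integrable A (volume.restrict Ω) := by
    refine ⟨hAm, ?_⟩
    rw [hasFiniteIntegral_iff_ofReal hAnn]
    refine lt_of_le_of_lt (b := ∫⁻ x in Ω, ENNReal.ofReal (D ^ p) *
      ENNReal.ofReal (L x * ‖G x‖ ^ p)) (lintegral_mono_ae ?_) ?_
    · filter_upwards [hL.pos] with x hx
      rw [← ENNReal.ofReal_mul (by positivity)]
      refine ENNReal.ofReal_le_ofReal ?_
      have h1 := hη0 x
      have h2 := hd0 (u x)
      calc A x ≤ L x * (1 * D * ‖G x‖) ^ p := by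
            simp only [hA]
            have := hη1 x
            have := hdD (u x)
            gcongr
        _ = _ := by rw [one_mul, Real.mul_rpow hD0 (norm_nonneg _)]; ring
    · rw [lintegral_const_mul' _ _ ENNReal.ofReal_ne_top]
      exact ENNReal.mul_lt_top ENNReal.ofReal_lt_top hG.lt_top
  have hTi : Integrable T (volume.restrict Ω) := by
    refine ⟨hTm, ?_⟩
    rw [hasFiniteIntegral_iff_ofReal hTnn]
    exact hTΩ.trans_lt (Ne.lt_top hTt)
  have hMi : Integrable M (volume.restrict Ω) := by
    refine Integrable.mono' ((hAi.const_mul 2).add (hTi.const_mul c)) hMm ?_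
    filter_upwards [hpt, hAnn] with x hx hx0
    rw [abs_le] at hx
    simp only [Pi.add_apply]
    rw [Real.norm_eq_abs, abs_le]
    constructor <;> linarith [hx.1, hx.2]
  have hint : ∫ x in Ω, A x ≤ 2 * |∫ x in Ω, M x| + 2 * (c * ∫ x in Ω, T x) := by
    have h1 : ∫ x in Ω, A x ≤ ∫ x in Ω, (2 * M x + 2 * (c * T x)) := by
      refine integral_mono_ae hAi ((hMi.const_mul 2).add ((hTi.const_mul c).const_mul 2)) ?_
      filter_upwards [hpt] with x hx
      rw [abs_le] at hx
      linarith [hx.1]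
    rw [integral_add (hMi.const_mul 2) ((hTi.const_mul c).const_mul 2), integral_const_mul,
      integral_const_mul, integral_const_mul] at h1
    linarith [le_abs_self (∫ x in Ω, M x)]
  -- By the equation, `∫ M` is the term with `K`, and `|u|^{p-1} |Φ(u)| ≤ (|u| d(u))^p`. The norm of
  -- an integral is at most the integral of norms even if the latter is infinite, so no
  -- integrability of the `K` term is needed.
  have hMle : ENNReal.ofReal |∫ x in Ω, M x| ≤
      ‖lam‖ₑ * ∫⁻ x in B, ‖K x‖ₑ * (‖η x‖ₑ * ‖u x * d (u x)‖ₑ) ^ p := by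
    rw [← Real.enorm_eq_ofReal_abs, hw, enorm_mul]
    gcongr
    refine (enorm_integral_le_lintegral_enorm _).trans ?_
    rw [← lintegral_indicator hBm]
    refine (lintegral_mono fun x => ?_).trans (setLIntegral_le_lintegral Ω _)
    by_cases hx : x ∈ B
    · rw [indicator_of_mem hx, ← enorm_mul, Real.enorm_eq_ofReal_abs (K x),
        ← ofReal_mul_norm_rpow _ _ hp0.le, ← ofReal_norm]
      refine ENNReal.ofReal_le_ofReal ?_
      have h1 := hη0 x
      have h2 := hd0 (u x)
      simp only [norm_mul, Real.norm_eq_abs, abs_of_nonneg h1, abs_of_nonneg h2, hζdef]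
      rw [abs_of_nonneg (Real.rpow_nonneg h1 p), abs_of_nonneg (Real.rpow_nonneg (abs_nonneg _) _),
        Real.mul_rpow h1 (by positivity), Real.mul_rpow (abs_nonneg _) h2]
      calc _ = |K x| * (|u x| ^ (p - 2) * |u x|) * (η x ^ p * |Φ (u x)|) := by ring
        _ ≤ |K x| * (|u x| ^ (p - 2) * |u x|) * (η x ^ p * (|u x| * d (u x) ^ p)) := by
          gcongr
          exact hΦle _
        _ = _ := by
          rw [rpow_sub_two_mul_self hp (abs_nonneg _), ← rpow_sub_one_mul_self hp (abs_nonneg (u x))]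
          ring
    · have : η x = 0 := image_eq_zero_of_notMem_tsupport fun hh => hx (hηB hh)
      simp [hζdef, this, hp0.ne']
  calc _ ≤ ∫⁻ x in Ω, ENNReal.ofReal (A x) := by
        simp_rw [← hAx]
        exact lintegral_mono_set hB
    _ = ENNReal.ofReal (∫ x in Ω, A x) := (ofReal_integral_eq_lintegral_ofReal hAi hAnn).symm
    _ ≤ ENNReal.ofReal (2 * |∫ x in Ω, M x| + 2 * (c * ∫ x in Ω, T x)) :=
        ENNReal.ofReal_le_ofReal hint
    _ ≤ 2 * ENNReal.ofReal |∫ x in Ω, M x| +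
        2 * (ENNReal.ofReal c * ∫⁻ x in Ω, ENNReal.ofReal (T x)) := by
        refine ENNReal.ofReal_add_le.trans ?_
        rw [ENNReal.ofReal_mul zero_le_two, ENNReal.ofReal_mul zero_le_two,
          ENNReal.ofReal_mul hc0.le, ofReal_integral_eq_lintegral_ofReal hTi hTnn,
          ENNReal.ofReal_ofNat]
    _ ≤ 2 * (‖lam‖ₑ * ∫⁻ x in B, ‖K x‖ₑ * (‖η x‖ₑ * ‖u x * d (u x)‖ₑ) ^ p) +
        2 * (ENNReal.ofReal c * ∫⁻ x in B, ENNReal.ofReal (T x)) := by gcongr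
    _ = _ := by
        simp_rw [hTx]
        ring

end

/-! ### Cutoff functions and truncated powers -/

section

variable {N : ℕ}

theorem exists_abs_deriv_smoothTransition_le :
    ∃ c : ℝ, 0 ≤ c ∧ ∀ t, |deriv Real.smoothTransition t| ≤ c := by
  have hc : Continuous (deriv Real.smoothTransition) :=
    (Real.smoothTransition.contDiff (n := 1)).continuous_deriv_one
  obtain ⟨c, hc'⟩ := (isCompact_Icc (a := (0 : ℝ)) (b := 1)).exists_bound_of_continuousOn
    hc.continuousOn
  have hc0 : 0 ≤ c := (norm_nonneg _).trans (hc' 0 (by simp))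
  refine ⟨c, hc0, fun t => ?_⟩
  rcases lt_or_ge t 0 with h | h
  · have : Real.smoothTransition =ᶠ[𝓝 t] fun _ => (0 : ℝ) := by
      filter_upwards [eventually_lt_nhds h] with x hx
      exact Real.smoothTransition.zero_of_nonpos hx.le
    simpa [this.deriv_eq] using hc0
  rcases lt_or_ge 1 t with h1 | h1
  · have : Real.smoothTransition =ᶠ[𝓝 t] fun _ => (1 : ℝ) := by
      filter_upwards [eventually_gt_nhds h1] with x hx
      exact Real.smoothTransition.one_of_one_le hx.le
    simpa [this.deriv_eq] using hc0
  · exact hc' t ⟨h, h1⟩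

/-- Cutoff functions between concentric balls. -/
theorem exists_cutoff : ∃ c : ℝ, 0 ≤ c ∧ ∀ (x₀ : EuclideanSpace ℝ (Fin N)) (r' r : ℝ), 0 < r' →
    r' < r → ∃ η : EuclideanSpace ℝ (Fin N) → ℝ, ContDiff ℝ 1 η ∧ HasCompactSupport η ∧
      tsupport η ⊆ Metric.ball x₀ r ∧ (∀ x, 0 ≤ η x) ∧ (∀ x, η x ≤ 1) ∧
      (∀ x ∈ Metric.ball x₀ r', η x = 1) ∧ ∀ x, ‖gradient η x‖ ≤ c / (r - r') := by
  obtain ⟨c, hc0, hc⟩ := exists_abs_deriv_smoothTransition_le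
  refine ⟨4 * c, by positivity, fun x₀ r' r hr' hr => ?_⟩
  -- The midpoint keeps the closed support strictly inside the outer ball. Composing with a function
  -- of `‖x - x₀‖²` avoids the singularity of the norm at the centre.
  set ρ := (r + r') / 2 with hρ
  have hρr : ρ < r := by linarith
  have hρr' : r' < ρ := by linarith
  have hk : 0 < ρ ^ 2 - r' ^ 2 := by nlinarith
  set g : EuclideanSpace ℝ (Fin N) → ℝ := fun x => (ρ ^ 2 - ‖x - x₀‖ ^ 2) / (ρ ^ 2 - r' ^ 2) with hg
  have hgc : ContDiff ℝ 1 g :=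
    (contDiff_const.sub ((contDiff_id.sub contDiff_const).norm_sq ℝ)).div_const _
  set η : EuclideanSpace ℝ (Fin N) → ℝ := fun x => Real.smoothTransition (g x) with hη
  have hsupp : tsupport η ⊆ Metric.closedBall x₀ ρ := by
    refine closure_minimal (fun x hx => ?_) Metric.isClosed_closedBall
    by_contra hxρ
    rw [Metric.mem_closedBall, not_le, dist_eq_norm] at hxρ
    refine hx (Real.smoothTransition.zero_of_nonpos (div_nonpos_of_nonpos_of_nonneg ?_ hk.le))
    nlinarith
  refine ⟨η, Real.smoothTransition.contDiff.comp hgc, ?_, ?_, fun x => Real.smoothTransition.nonneg _,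
    fun x => Real.smoothTransition.le_one _, fun x hx => ?_, fun x => ?_⟩
  · exact (isCompact_closedBall x₀ ρ).of_isClosed_subset (isClosed_tsupport _) hsupp
  · exact hsupp.trans (Metric.closedBall_subset_ball hρr)
  · rw [Metric.mem_ball, dist_eq_norm] at hx
    refine Real.smoothTransition.one_of_one_le ?_
    rw [hg, le_div_iff₀ hk, one_mul]
    nlinarith [norm_nonneg (x - x₀)]
  · by_cases hx : x ∈ tsupport η
    · have hxρ := hsupp hx
      rw [Metric.mem_closedBall, dist_eq_norm] at hxρ
      have h1 : HasFDerivAt (fun y : EuclideanSpace ℝ (Fin N) => ‖y - x₀‖ ^ 2) _ x :=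
        ((hasFDerivAt_id x).sub_const x₀).norm_sq
      have h2 : HasFDerivAt g _ x := (h1.const_sub (ρ ^ 2)).mul_const ((ρ ^ 2 - r' ^ 2)⁻¹)
      have h3 : HasFDerivAt η _ x := ((Real.smoothTransition.contDiff (n := 1)).differentiable
        one_ne_zero (g x)).hasDerivAt.comp_hasFDerivAt x h2
      rw [gradient, LinearIsometryEquiv.norm_map, h3.fderiv]
      refine ContinuousLinearMap.opNorm_le_bound _ (div_nonneg (by positivity) (by linarith))
        fun v => ?_
      have h4 : |inner ℝ (x - x₀) v| ≤ ρ * ‖v‖ :=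
        (abs_real_inner_le_norm _ _).trans (by gcongr)
      have e : ‖(deriv Real.smoothTransition (g x) • ((ρ ^ 2 - r' ^ 2)⁻¹ •
          -(2 • (innerSL ℝ (x - x₀)).comp (ContinuousLinearMap.id ℝ _))) :
          EuclideanSpace ℝ (Fin N) →L[ℝ] ℝ) v‖ =
          |deriv Real.smoothTransition (g x)| * ((ρ ^ 2 - r' ^ 2)⁻¹ *
            (2 * |inner ℝ (x - x₀) v|)) := by
        simp [abs_of_pos hk, inner_sub_left]
      refine e.trans_le ?_
      calc _ ≤ c * ((ρ ^ 2 - r' ^ 2)⁻¹ * (2 * (ρ * ‖v‖))) := by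
            gcongr
            exact hc _
        _ = 2 * c * (ρ / (ρ ^ 2 - r' ^ 2)) * ‖v‖ := by ring
        -- Here `ρ² - r'² = (ρ + r')(r - r')/2` and `ρ ≤ ρ + r'`.
        _ ≤ 2 * c * (2 / (r - r')) * ‖v‖ := by
            refine mul_le_mul_of_nonneg_right (mul_le_mul_of_nonneg_left ?_ (by positivity))
              (norm_nonneg v)
            rw [div_le_div_iff₀ hk (by linarith)]
            nlinarith
        _ = _ := by ring
    · rw [gradient_eq_zero_of_notMem_tsupport hx, norm_zero]
      exact div_nonneg (by positivity) (by linarith)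

/-- On the interval between `0` and `t` the integrand is at most `e t`. It serves for both
primitives, of `d` and of `d^p`. -/
theorem abs_integral_le_of_even_mono {e : ℝ → ℝ} (he0 : ∀ t, 0 ≤ e t)
    (hmono : ∀ s t, |s| ≤ |t| → e s ≤ e t) (t : ℝ) : |∫ τ in (0 : ℝ)..t, e τ| ≤ |t| * e t := by
  have h := intervalIntegral.norm_integral_le_of_norm_le_const (a := 0) (b := t) (f := e)
    (C := e t) fun x hx => by
      rw [Real.norm_of_nonneg (he0 x)]
      refine hmono _ _ ?_
      rcases le_total 0 t with h | h
      · rw [uIoc_of_le h] at hx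
        rw [abs_of_pos hx.1, abs_of_nonneg h]
        exact hx.2
      · rw [uIoc_of_ge h] at hx
        rw [abs_of_nonpos hx.2, abs_of_nonpos h]
        linarith [hx.1]
  rwa [sub_zero, mul_comm, Real.norm_eq_abs] at h

theorem abs_integral_abs_rpow {β : ℝ} (hβ : 1 ≤ β) (t : ℝ) :
    |∫ τ in (0 : ℝ)..t, β * |τ| ^ (β - 1)| = |t| ^ β := by
  have key : ∀ t : ℝ, 0 ≤ t → ∫ τ in (0 : ℝ)..t, β * |τ| ^ (β - 1) = t ^ β := fun t ht => by
    have : ∫ τ in (0 : ℝ)..t, β * |τ| ^ (β - 1) = ∫ τ in (0 : ℝ)..t, β * τ ^ (β - 1) := by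
      refine intervalIntegral.integral_congr fun τ hτ => ?_
      rw [uIcc_of_le ht] at hτ
      simp only [abs_of_nonneg hτ.1]
    rw [this, intervalIntegral.integral_const_mul, integral_rpow (.inl (by linarith)),
      sub_add_cancel, Real.zero_rpow (by linarith), sub_zero]
    field_simp
  rcases le_total 0 t with h | h
  · rw [key t h, abs_of_nonneg h, abs_of_nonneg (by positivity)]
  · have h1 : ∫ τ in (0 : ℝ)..(-t), β * |τ| ^ (β - 1) = -∫ τ in (0 : ℝ)..t, β * |τ| ^ (β - 1) := by
      have := intervalIntegral.integral_comp_neg (a := 0) (b := t) fun τ => β * |τ| ^ (β - 1)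
      simp only [abs_neg, neg_zero] at this
      rw [this, intervalIntegral.integral_symm]
    have h2 := key (-t) (by linarith)
    rw [h1] at h2
    rw [← abs_neg, h2, abs_of_nonneg (by have : 0 ≤ -t := by linarith
                                         positivity), abs_of_nonpos h]

/-- The derivative of the power `|t|^β`, truncated at `|t| = m`. -/
def truncDeriv (β m t : ℝ) : ℝ := β * min |t| m ^ (β - 1)

section truncDeriv

variable {β m : ℝ}

/-- The case `β = 1` is included: the exponent is zero, `0^0 = 1`, and the function is the constant
`1`. The iteration starts there. -/
theorem continuous_truncDeriv (hβ : 1 ≤ β) : Continuous (truncDeriv β m) :=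
  continuous_const.mul ((continuous_abs.min continuous_const).rpow_const
    fun _ => .inr (by linarith))

theorem truncDeriv_nonneg (hβ : 1 ≤ β) (hm : 0 ≤ m) (t : ℝ) : 0 ≤ truncDeriv β m t := by
  have : 0 ≤ min |t| m := le_min (abs_nonneg _) hm
  unfold truncDeriv
  positivity

theorem truncDeriv_le (hβ : 1 ≤ β) (hm : 0 ≤ m) (t : ℝ) :
    truncDeriv β m t ≤ β * m ^ (β - 1) := by
  have : 0 ≤ min |t| m := le_min (abs_nonneg _) hm
  unfold truncDeriv
  gcongr
  exact min_le_right _ _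

theorem truncDeriv_mono (hβ : 1 ≤ β) (hm : 0 ≤ m) {s t : ℝ} (h : |s| ≤ |t|) :
    truncDeriv β m s ≤ truncDeriv β m t := by
  have : 0 ≤ min |s| m := le_min (abs_nonneg _) hm
  unfold truncDeriv
  gcongr

/-- The bound is free of the truncation height `m`, so it survives `m → ∞`. -/
theorem enorm_mul_truncDeriv_le (hβ : 1 ≤ β) (hm : 0 ≤ m) (t : ℝ) :
    ‖t * truncDeriv β m t‖ₑ ≤ ENNReal.ofReal β * ‖t‖ₑ ^ β := by
  have h0 : 0 ≤ min |t| m := le_min (abs_nonneg _) hm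
  rw [← Real.norm_eq_abs] at h0
  rw [← ofReal_norm, ← ofReal_mul_norm_rpow _ _ (by linarith), norm_mul,
    Real.norm_of_nonneg (truncDeriv_nonneg hβ hm t)]
  refine ENNReal.ofReal_le_ofReal ?_
  unfold truncDeriv
  rcases eq_or_ne t 0 with rfl | ht
  · simp [Real.zero_rpow (show β ≠ 0 by linarith)]
  · have hpos : 0 < ‖t‖ := norm_pos_iff.2 ht
    calc ‖t‖ * (β * min |t| m ^ (β - 1)) ≤ ‖t‖ * (β * ‖t‖ ^ (β - 1)) := by
          rw [← Real.norm_eq_abs]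
          gcongr
          exact min_le_left _ _
      _ = β * (‖t‖ ^ (β - 1) * ‖t‖) := by ring
      _ = _ := by rw [← Real.rpow_add_one hpos.ne', sub_add_cancel]

theorem integral_truncDeriv_eq {t : ℝ} (ht : |t| ≤ m) :
    ∫ τ in (0 : ℝ)..t, truncDeriv β m τ = ∫ τ in (0 : ℝ)..t, β * |τ| ^ (β - 1) := by
  refine intervalIntegral.integral_congr fun τ hτ => ?_
  have : |τ| ≤ |t| := by
    have := abs_sub_left_of_mem_uIcc hτ
    simpa using this
  simp only [truncDeriv, min_eq_left (this.trans ht)]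

end truncDeriv

end

/-! ### The Moser iteration step and the passage to the supremum -/

section

variable {N : ℕ}

/-- Meant for `w = |η|` and `w = |∇η|`: the weight is measured on the fixed ball `B`, so its norm is
the same at all steps, while `W` is integrated only where the cutoff lives. -/
theorem lintegral_enorm_mul_localized_rpow_le {B B' : Set (EuclideanSpace ℝ (Fin N))}
    (hB'm : MeasurableSet B') (hB' : B' ⊆ B) {L : EuclideanSpace ℝ (Fin N) → ℝ}
    (hL : AEMeasurable L (volume.restrict B)) {W w : EuclideanSpace ℝ (Fin N) → ℝ≥0∞}
    (hW : AEMeasurable W (volume.restrict B)) {γ : ℝ≥0∞} (hγ : γ ≠ ⊤) (hw : ∀ x, w x ≤ γ)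
    (hw0 : ∀ x ∉ B', w x = 0) {p q : ℝ} (hp : 0 < p) (hpq : p ≤ q) :
    ∫⁻ x in B, ‖L x‖ₑ * (w x * W x) ^ p ≤ γ ^ p *
      (eLpNorm L (weightExponent p q) (volume.restrict B) *
        (∫⁻ x in B', W x ^ q) ^ (p / q)) := by
  have hle := Measure.restrict_mono hB' (le_refl (volume : Measure (EuclideanSpace ℝ (Fin N))))
  calc _ ≤ ∫⁻ x in B', γ ^ p * (‖L x‖ₑ * W x ^ p) := by
        rw [← lintegral_indicator hB'm]
        refine (lintegral_mono fun x => ?_).trans (setLIntegral_le_lintegral B _)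
        by_cases hx : x ∈ B'
        · rw [indicator_of_mem hx, mul_left_comm, ← ENNReal.mul_rpow_of_nonneg _ _ hp.le]
          gcongr
          exact hw x
        · simp [hw0 x hx, hp]
    _ ≤ _ := by
        rw [lintegral_const_mul' _ _ (ENNReal.rpow_ne_top_of_nonneg hp.le hγ)]
        refine mul_le_mul_right ((lintegral_enorm_mul_rpow_le (hL.mono_measure hle)
          (hW.mono_measure hle) hp hpq).trans ?_) _
        exact mul_le_mul_left (eLpNorm_mono_measure L hle) _

/-- One step of the Moser iteration. -/
theorem exists_lintegral_rpow_le_moser (hN : 1 ≤ N) {p s q τ lam r₀ : ℝ} (hp : 1 < p) (hs : 0 < s)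
    (ha : 1 ≤ pSub p s) (haτ : pSub p s ≤ τ) (hpq : p ≤ q) (hτ : 1 < τ)
    (hκ : N * (1 / pSub p s - 1 / τ) < 1) (hr₀ : 0 < r₀) :
    ∃ C : ℝ≥0∞, C ≠ ⊤ ∧ ∀ {Ω : Set (EuclideanSpace ℝ (Fin N))}
      {L K u : EuclideanSpace ℝ (Fin N) → ℝ}
      {G : EuclideanSpace ℝ (Fin N) → EuclideanSpace ℝ (Fin N)}
      {φ : ℕ → EuclideanSpace ℝ (Fin N) → ℝ} {x₀ : EuclideanSpace ℝ (Fin N)},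
      IsApprox p q Ω L (Metric.ball x₀ r₀) u G φ → IsWeight Ω L → Metric.ball x₀ r₀ ⊆ Ω →
      AEMeasurable K (volume.restrict (Metric.ball x₀ r₀)) →
      eLpNorm L (weightExponent p q) (volume.restrict (Metric.ball x₀ r₀)) ≠ ⊤ →
      ∫⁻ x in Ω, ENNReal.ofReal (L x * ‖G x‖ ^ p) ≠ ⊤ →
      ∫⁻ x in Metric.ball x₀ r₀, ENNReal.ofReal (L x) ^ (-s) ≠ ⊤ →
      (∀ (ψ : EuclideanSpace ℝ (Fin N) → ℝ)
        (H : EuclideanSpace ℝ (Fin N) → EuclideanSpace ℝ (Fin N)), MemD p Ω L ψ H →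
        ∫ x in Ω, L x * ‖G x‖ ^ (p - 2) * inner ℝ (G x) (H x) =
          lam * ∫ x in Ω, K x * |u x| ^ (p - 2) * u x * ψ x) →
      ∀ {β r' r : ℝ}, 1 ≤ β → 0 < r' → r' < r → r ≤ r₀ →
      ∫⁻ x in Metric.ball x₀ r', ‖u x‖ₑ ^ (β * τ) ≤
        (C * ((∫⁻ x in Metric.ball x₀ r₀, ENNReal.ofReal (L x) ^ (-s)) ^ (1 / s) *
          (eLpNorm L (weightExponent p q) (volume.restrict (Metric.ball x₀ r₀)) +
            eLpNorm K (weightExponent p q) (volume.restrict (Metric.ball x₀ r₀)))) *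
          (ENNReal.ofReal (1 + 1 / (r - r')) * ENNReal.ofReal β) ^ p *
          (∫⁻ x in Metric.ball x₀ r, ‖u x‖ₑ ^ (β * q)) ^ (p / q)) ^ (τ / p) := by
  have : Nonempty (Fin N) := ⟨⟨0, hN⟩⟩
  have hp0 : 0 < p := by linarith
  have hq0 : 0 < q := by linarith
  have hτ0 : 0 < τ := by linarith
  obtain ⟨CS, hCS, hsob⟩ := exists_lintegral_rpow_le_of_tsupport_subset
    (E := EuclideanSpace ℝ (Fin N)) volume ha haτ hτ (by simpa using hκ) hr₀
  obtain ⟨c, hc0, hcut⟩ := exists_cutoff (N := N)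
  set κ := ENNReal.ofReal (p * (2 * p) ^ (p - 1))
  have h2t : (2 : ℝ≥0∞) ^ (p - 1) ≠ ⊤ := ENNReal.rpow_ne_top_of_nonneg (by linarith) (by simp)
  -- One factor `2^{p-1}` comes from approximation in the Sobolev inequality, the other from
  -- splitting the gradient of `η Φ(u)`. In the sum, `2κ` and `2‖lam‖ₑ` are the Caccioppoli
  -- constants and `1` accounts for `Φ(u) ∇η`.
  set C₁ : ℝ≥0∞ := 2 ^ (p - 1) * (2 ^ (p - 1) * (2 * κ + 2 * ‖lam‖ₑ + 1)) with hC₁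
  have hct : ENNReal.ofReal (1 + c) ^ p ≠ ⊤ :=
    ENNReal.rpow_ne_top_of_nonneg hp0.le ENNReal.ofReal_ne_top
  refine ⟨CS ^ (p / τ) * C₁ * ENNReal.ofReal (1 + c) ^ p, by
    have := ENNReal.rpow_ne_top_of_nonneg (show 0 ≤ p / τ by positivity) hCS
    have : ‖lam‖ₑ ≠ ⊤ := enorm_ne_top
    finiteness, ?_⟩
  intro Ω L K u G φ x₀ h hL hB hK hLB hG hΛ hweak β r' r hβ hr' hr'r hr
  set B := Metric.ball x₀ r₀
  set B' := Metric.ball x₀ r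
  have hB'B : B' ⊆ B := Metric.ball_subset_ball hr
  have hBm : MeasurableSet B := measurableSet_ball
  set Λ := ∫⁻ x in B, ENNReal.ofReal (L x) ^ (-s)
  set NL := eLpNorm L (weightExponent p q) (volume.restrict B)
  set NK := eLpNorm K (weightExponent p q) (volume.restrict B)
  set J := ∫⁻ x in B', ‖u x‖ₑ ^ (β * q)
  obtain ⟨η, hη, hηc, hηB', hη0, hη1, hηone, hηgrad⟩ := hcut x₀ r' r hr' hr'r
  have hrr : 0 < r - r' := by linarith
  -- A common bound for the cutoff and its gradient.
  set γ := ENNReal.ofReal (1 + c) * ENNReal.ofReal (1 + 1 / (r - r')) with hγ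
  have hγt : γ ≠ ⊤ := by finiteness
  have hγgrad : ∀ x, ‖gradient η x‖ₑ ≤ γ := fun x => by
    rw [hγ, ← ENNReal.ofReal_mul (by positivity), ← ofReal_norm]
    refine ENNReal.ofReal_le_ofReal ((hηgrad x).trans ?_)
    have : 0 ≤ 1 / (r - r') := by positivity
    rw [div_eq_mul_one_div]
    nlinarith
  have hγη : ∀ x, ‖η x‖ₑ ≤ γ := fun x => by
    rw [hγ, ← ENNReal.ofReal_mul (by positivity), ← ofReal_norm]
    refine ENNReal.ofReal_le_ofReal ?_
    rw [Real.norm_of_nonneg (hη0 x)]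
    refine (hη1 x).trans ?_
    have : 0 ≤ 1 / (r - r') := by positivity
    nlinarith
  have hle := Measure.restrict_mono hB (le_refl (volume : Measure (EuclideanSpace ℝ (Fin N))))
  have hu := h.aestronglyMeasurable.mono_measure hle
  have hLm := hL.aemeasurable.mono_measure hle
  have hGm := h.aestronglyMeasurable_gradient.mono_measure hle
  have hηgm : AEMeasurable (fun x => ‖gradient η x‖ₑ) (volume.restrict B) :=
    hη.continuous_gradient.enorm.measurable.aemeasurable
  set R := (CS ^ (p / τ) * C₁ * ENNReal.ofReal (1 + c) ^ p * (Λ ^ (1 / s) * (NL + NK)) *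
    (ENNReal.ofReal (1 + 1 / (r - r')) * ENNReal.ofReal β) ^ p * J ^ (p / q)) ^ (τ / p) with hR
  have main : ∀ m : ℕ, ∫⁻ x in Metric.ball x₀ r',
      ‖∫ t in (0 : ℝ)..u x, truncDeriv β m t‖ₑ ^ τ ≤ R := fun m => by
    have hm : (0 : ℝ) ≤ m := m.cast_nonneg
    set d := truncDeriv β m with hd
    have hdc : Continuous d := continuous_truncDeriv hβ
    have hd0 : ∀ t, 0 ≤ d t := truncDeriv_nonneg hβ hm
    have hdp : Continuous fun t => d t ^ p := hdc.rpow_const fun _ => .inr hp0.le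
    set W : EuclideanSpace ℝ (Fin N) → ℝ≥0∞ := fun x => ‖u x * d (u x)‖ₑ with hW
    have hWm : AEMeasurable W (volume.restrict B) :=
      (hu.mul (hdc.comp_aestronglyMeasurable hu)).enorm
    have hWq : (∫⁻ x in B', W x ^ q) ^ (p / q) ≤ ENNReal.ofReal β ^ p * J ^ (p / q) := by
      calc _ ≤ (∫⁻ x in B', ENNReal.ofReal β ^ q * ‖u x‖ₑ ^ (β * q)) ^ (p / q) := by
            refine ENNReal.rpow_le_rpow (lintegral_mono fun x => ?_) (by positivity)
            dsimp only
            rw [ENNReal.rpow_mul, ← ENNReal.mul_rpow_of_nonneg _ _ hq0.le]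
            exact ENNReal.rpow_le_rpow (enorm_mul_truncDeriv_le hβ hm _) hq0.le
        _ = _ := by
            rw [lintegral_const_mul' _ _ (ENNReal.rpow_ne_top_of_nonneg hq0.le
              ENNReal.ofReal_ne_top), ENNReal.mul_rpow_of_nonneg _ _ (by positivity),
              ← ENNReal.rpow_mul, mul_div_cancel₀ _ hq0.ne']
    set Y := γ ^ p * (ENNReal.ofReal β ^ p * J ^ (p / q)) with hY
    have hX₁ : ∫⁻ x in B, ENNReal.ofReal (L x) * (W x * ‖gradient η x‖ₑ) ^ p ≤ NL * Y := by
      calc _ ≤ ∫⁻ x in B, ‖L x‖ₑ * (‖gradient η x‖ₑ * W x) ^ p := by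
            refine lintegral_mono fun x => ?_
            dsimp only
            rw [mul_comm (W x)]
            gcongr
            exact Real.ofReal_le_enorm _
        _ ≤ _ := lintegral_enorm_mul_localized_rpow_le measurableSet_ball hB'B hLm hWm hγt hγgrad
            (fun x hx => by
              rw [gradient_eq_zero_of_notMem_tsupport fun hh => hx (hηB' hh), enorm_zero]) hp0 hpq
        _ ≤ γ ^ p * (NL * (ENNReal.ofReal β ^ p * J ^ (p / q))) := by gcongr
        _ = _ := by rw [hY]; ring
    have hX₂ : ∫⁻ x in B, ‖K x‖ₑ * (‖η x‖ₑ * W x) ^ p ≤ NK * Y := by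
      calc _ ≤ _ := lintegral_enorm_mul_localized_rpow_le measurableSet_ball hB'B hK hWm hγt hγη
            (fun x hx => by
              rw [image_eq_zero_of_notMem_tsupport fun hh => hx (hηB' hh), enorm_zero]) hp0 hpq
        _ ≤ γ ^ p * (NK * (ENNReal.ofReal β ^ p * J ^ (p / q))) := by gcongr
        _ = _ := by rw [hY]; ring
    -- The test function uses the primitive of `d^p`, whereas the Sobolev inequality below is
    -- applied to the primitive of `d` itself.
    have hcacc := h.caccioppoli hp hpq hL hBm hB hLB hG hweak hη hηc (hηB'.trans hB'B) hη0 hη1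
      (d := d) (Φ := fun t => ∫ τ in (0 : ℝ)..t, d τ ^ p) hdc hd0 (truncDeriv_le hβ hm)
      (fun t => (hdp.integral_hasStrictDerivAt 0 t).hasDerivAt)
      (abs_integral_le_of_even_mono (fun t => Real.rpow_nonneg (hd0 t) p) fun a b hab =>
        Real.rpow_le_rpow (hd0 a) (truncDeriv_mono hβ hm hab) hp0.le)
    set Φ : ℝ → ℝ := fun t => ∫ τ in (0 : ℝ)..t, d τ with hΦ
    have hΦd : ∀ t, HasDerivAt Φ (d t) t := fun t =>
      (hdc.integral_hasStrictDerivAt 0 t).hasDerivAt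
    have hΦderiv : deriv Φ = d := funext fun t => (hΦd t).deriv
    have hΦ1 : ContDiff ℝ 1 Φ := contDiff_one_iff_deriv.2
      ⟨fun t => (hΦd t).differentiableAt, hΦderiv ▸ hdc⟩
    have hΦle : ∀ t, |Φ t| ≤ |t| * d t :=
      abs_integral_le_of_even_mono hd0 fun a b hab => truncDeriv_mono hβ hm hab
    have hsobolev := h.lintegral_mul_comp_rpow_le hp hpq hL hBm hB hLB hG hη hηc
      (hηB'.trans hB'B) hΦ1 (D := β * (m : ℝ) ^ (β - 1)) (fun t => by
        rw [hΦderiv, abs_of_nonneg (hd0 t)]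
        exact truncDeriv_le hβ hm t) hs hΛ hτ0 hCS (fun f => hsob x₀ f)
    rw [hΦderiv] at hsobolev
    have henergy : ∫⁻ x in B, ENNReal.ofReal (L x) *
        ‖(η x * d (u x)) • G x + Φ (u x) • gradient η x‖ₑ ^ p ≤
        2 ^ (p - 1) * (2 * κ + 2 * ‖lam‖ₑ + 1) * ((NL + NK) * Y) := by
      have h1 := lintegral_mul_add_rpow_le (ν := volume.restrict B)
        (ℓ := fun x => ENNReal.ofReal (L x)) (f := fun x => ‖(η x * d (u x)) • G x‖ₑ)
        (g := fun x => W x * ‖gradient η x‖ₑ)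
        (h := fun x => ‖(η x * d (u x)) • G x + Φ (u x) • gradient η x‖ₑ) hLm.ennreal_ofReal
        (((hη.continuous.aestronglyMeasurable.mul
          (hdc.comp_aestronglyMeasurable hu)).smul hGm).enorm)
        (ae_of_all _ fun x => by
          refine (enorm_add_le _ _).trans (add_le_add_right ?_ _)
          rw [enorm_smul]
          refine mul_le_mul_left ?_ _
          simp only [hW]
          rw [← ofReal_norm, ← ofReal_norm]
          refine ENNReal.ofReal_le_ofReal ?_
          rw [norm_mul, Real.norm_of_nonneg (hd0 _)]
          exact hΦle _) hp.le
      refine h1.trans ?_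
      rw [mul_assoc]
      refine mul_le_mul_right ?_ _
      calc _ ≤ (2 * κ * (NL * Y) + 2 * ‖lam‖ₑ * (NK * Y)) + NL * Y := by
            refine add_le_add (hcacc.trans (add_le_add ?_ ?_)) hX₁
            · exact mul_le_mul_right hX₁ _
            · exact mul_le_mul_right hX₂ _
        _ ≤ (2 * κ * ((NL + NK) * Y) + 2 * ‖lam‖ₑ * ((NL + NK) * Y)) + (NL + NK) * Y := by
            gcongr
            · exact le_self_add
            · exact le_add_self
            · exact le_self_add
        _ = _ := by ring
    calc _ ≤ ∫⁻ x in B, ‖η x * Φ (u x)‖ₑ ^ τ := by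
          refine le_trans (le_of_eq ?_) (lintegral_mono_set
            (Metric.ball_subset_ball (show r' ≤ r₀ by linarith)))
          refine setLIntegral_congr_fun measurableSet_ball fun x hx => ?_
          simp only [hηone x hx, one_mul, hΦ]
      _ ≤ _ := hsobolev
      _ ≤ CS * (Λ ^ (1 / s) * (2 ^ (p - 1) *
          (2 ^ (p - 1) * (2 * κ + 2 * ‖lam‖ₑ + 1) * ((NL + NK) * Y)))) ^ (τ / p) := by
          gcongr
      _ = R := by
          -- The Sobolev constant is moved inside the power `τ/p`, so that the whole step is a
          -- single power.
          have e : CS = (CS ^ (p / τ)) ^ (τ / p) := by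
            rw [← ENNReal.rpow_mul, div_mul_div_cancel₀ hτ0.ne', div_self hp0.ne',
              ENNReal.rpow_one]
          nth_rw 1 [e]
          rw [hR, ← ENNReal.mul_rpow_of_nonneg _ _ (by positivity), hY, hγ, hC₁]
          congr 1
          rw [ENNReal.mul_rpow_of_nonneg _ _ hp0.le, ENNReal.mul_rpow_of_nonneg _ _ hp0.le]
          ring
  have hub := hu.mono_measure (Measure.restrict_mono (Metric.ball_subset_ball
    (show r' ≤ r₀ by linarith) : Metric.ball x₀ r' ⊆ B) (le_refl volume))
  have hfin := lintegral_rpow_le_of_tendsto (ν := volume.restrict (Metric.ball x₀ r')) (τ := τ)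
    (f := fun (m : ℕ) x => ∫ t in (0 : ℝ)..u x, truncDeriv β m t)
    (g := fun x => ∫ t in (0 : ℝ)..u x, β * |t| ^ (β - 1)) (b := fun _ => R) (b₀ := R)
    (fun m => ?_) (ae_of_all _ fun x => ?_) main tendsto_const_nhds
  · refine le_of_eq_of_le (lintegral_congr fun x => ?_) hfin
    rw [Real.enorm_eq_ofReal_abs (∫ t in (0 : ℝ)..u x, β * |t| ^ (β - 1)),
      abs_integral_abs_rpow hβ, ← ENNReal.ofReal_rpow_of_nonneg (abs_nonneg _) (by linarith),
      ← Real.enorm_eq_ofReal_abs, ← ENNReal.rpow_mul]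
  · have hc : Continuous fun t : ℝ => ∫ τ in (0 : ℝ)..t, truncDeriv β m τ :=
      continuous_iff_continuousAt.2 fun t =>
        ((continuous_truncDeriv hβ).integral_hasStrictDerivAt 0 t).hasDerivAt.continuousAt
    exact hc.comp_aestronglyMeasurable hub
  -- At each point the truncated primitives are eventually constant: nothing is truncated once `m ≥
  -- |u x|`.
  · refine tendsto_const_nhds.congr' ?_
    filter_upwards [eventually_ge_atTop ⌈|u x|⌉₊] with m hm
    exact (integral_truncDeriv_eq ((Nat.le_ceil _).trans (by exact_mod_cast hm))).symm

theorem tendsto_const_rpow {x : ℝ≥0∞} (h0 : x ≠ 0) (ht : x ≠ ⊤) {y : ℕ → ℝ} {y₀ : ℝ}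
    (hy : Tendsto y atTop (𝓝 y₀)) : Tendsto (fun n => x ^ y n) atTop (𝓝 (x ^ y₀)) := by
  lift x to NNReal using ht
  have hx : x ≠ 0 := by simpa using h0
  simp_rw [← ENNReal.coe_rpow_of_ne_zero hx]
  rw [ENNReal.tendsto_coe, ← NNReal.tendsto_coe]
  simp_rw [NNReal.coe_rpow]
  exact (Real.continuousAt_const_rpow (by exact_mod_cast hx)).tendsto.comp hy

/-- Bounds for `L^σ` norms along exponents tending to infinity yield a bound for the `L^∞` norm. -/
theorem eLpNorm_top_le_of_tendsto {α : Type*} [MeasurableSpace α] {ν : Measure α}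
    [IsFiniteMeasure ν] {u : α → ℝ} (hu : AEStronglyMeasurable u ν) {σ : ℕ → ℝ}
    (hσ0 : ∀ k, 0 < σ k) (hσ : Tendsto σ atTop atTop) {Y : ℕ → ℝ≥0∞} {Y₀ : ℝ≥0∞}
    (hle : ∀ k, (∫⁻ x, ‖u x‖ₑ ^ σ k ∂ν) ^ (1 / σ k) ≤ Y k) (hY : Tendsto Y atTop (𝓝 Y₀)) :
    eLpNorm u ⊤ ν ≤ Y₀ := by
  rw [eLpNorm_exponent_top]
  refine le_of_forall_lt fun c hc => ?_
  obtain ⟨c', hcc', hc'⟩ := exists_between hc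
  refine hcc'.trans_le ?_
  -- Chebyshev: a level `c'` below the essential supremum is reached on a set of positive measure
  -- `δ`, so `c' δ^{1/σ k} ≤ Y k`, and `δ^{1/σ k} → 1`.
  set δ := ν {x | c' ≤ ‖u x‖ₑ}
  have hδ0 : δ ≠ 0 := fun h0 => by
    refine hc'.not_ge (essSup_le_of_ae_le _ ?_)
    have : ∀ᵐ x ∂ν, ¬ c' ≤ ‖u x‖ₑ := measure_eq_zero_iff_ae_notMem.1 h0
    filter_upwards [this] with x hx using (not_le.1 hx).le
  have h1 : Tendsto (fun k => c' * δ ^ (1 / σ k)) atTop (𝓝 c') := by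
    have := tendsto_const_rpow hδ0 (measure_ne_top ν _) (y₀ := 0)
      (by simp_rw [one_div]; exact hσ.inv_tendsto_atTop : Tendsto (fun k => 1 / σ k) atTop (𝓝 0))
    simpa using ENNReal.Tendsto.const_mul (a := c') this (.inl (by simp))
  refine le_of_tendsto_of_tendsto' h1 hY fun k => le_trans ?_ (hle k)
  have hk := hσ0 k
  have h2 := mul_meas_ge_le_lintegral₀ (hu.enorm.pow_const (σ k)) (c' ^ σ k)
  have h3 : {x | c' ^ σ k ≤ ‖u x‖ₑ ^ σ k} = {x | c' ≤ ‖u x‖ₑ} := by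
    ext x
    exact ENNReal.rpow_le_rpow_iff hk
  rw [h3] at h2
  calc c' * δ ^ (1 / σ k) = (c' ^ σ k * δ) ^ (1 / σ k) := by
        rw [ENNReal.mul_rpow_of_nonneg _ _ (by positivity), ← ENNReal.rpow_mul,
          mul_one_div_cancel hk.ne', ENNReal.rpow_one]
    _ ≤ _ := ENNReal.rpow_le_rpow h2 (by positivity)

/-- Unrolling the recursion multiplies the factors, so the exponents of `Q` and `b` are partial sums
of `∑ x^j` and `∑ j x^j`, both convergent for `x < 1`. -/
theorem le_rpow_sum_mul {a : ℕ → ℝ≥0∞} {Q b : ℝ≥0∞} {p x : ℝ} (hp : 0 < p) (hx : 0 < x)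
    (h : ∀ k, a (k + 1) ≤ (Q * b ^ k) ^ (x ^ k / p) * a k) (k : ℕ) :
    a k ≤ Q ^ ((∑ j ∈ Finset.range k, x ^ j) / p) *
      b ^ ((∑ j ∈ Finset.range k, j * x ^ j) / p) * a 0 := by
  induction k with
  | zero => simp
  | succ k ih =>
    refine (h k).trans ((mul_le_mul_right ih _).trans (le_of_eq ?_))
    rw [Finset.sum_range_succ, Finset.sum_range_succ, add_div, add_div,
      ENNReal.rpow_add_of_nonneg _ _ (by positivity) (by positivity),
      ENNReal.rpow_add_of_nonneg _ _ (by positivity) (by positivity),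
      ENNReal.mul_rpow_of_nonneg _ _ (by positivity), ← ENNReal.rpow_natCast, ← ENNReal.rpow_mul,
      mul_div_assoc]
    ring

end

/-! ### The local supremum bound and its consequences -/

section

variable {N : ℕ}

/-- Positivity of the limit exponent admits the base `0`, so the constants of the iteration need not
be shown nonzero. -/
theorem tendsto_const_rpow_of_pos {x : ℝ≥0∞} (ht : x ≠ ⊤) {y : ℕ → ℝ} {y₀ : ℝ} (hy₀ : 0 < y₀)
    (hy : Tendsto y atTop (𝓝 y₀)) : Tendsto (fun n => x ^ y n) atTop (𝓝 (x ^ y₀)) := by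
  rcases eq_or_ne x 0 with rfl | h0
  · refine tendsto_const_nhds.congr' ?_
    filter_upwards [hy.eventually_const_lt hy₀] with n hn
    rw [ENNReal.zero_rpow_of_pos hn, ENNReal.zero_rpow_of_pos hy₀]
  · exact tendsto_const_rpow h0 ht hy

/-- The local boundedness estimate. -/
theorem exists_eLpNorm_top_le (hN : 1 ≤ N) {p s q lam r₀ μ : ℝ} (hp : 1 < p) (hs : 0 < s)
    (ha : 1 ≤ pSub p s) (haq : pSub p s ≤ q) (hpq : p ≤ q) (hμ : 0 < μ) (hμ1 : μ < 1)
    (hκ : N * (1 / pSub p s - 1 / (q / (1 - μ))) < 1) (hr₀ : 0 < r₀) :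
    ∃ C : ℝ≥0∞, C ≠ ⊤ ∧ ∀ {Ω : Set (EuclideanSpace ℝ (Fin N))}
      {L K u : EuclideanSpace ℝ (Fin N) → ℝ}
      {G : EuclideanSpace ℝ (Fin N) → EuclideanSpace ℝ (Fin N)}
      {φ : ℕ → EuclideanSpace ℝ (Fin N) → ℝ} {x₀ : EuclideanSpace ℝ (Fin N)},
      IsApprox p q Ω L (Metric.ball x₀ r₀) u G φ → IsWeight Ω L → Metric.ball x₀ r₀ ⊆ Ω →
      MemLp L (weightExponent p q) (volume.restrict (Metric.ball x₀ r₀)) →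
      MemLp K (weightExponent p q) (volume.restrict (Metric.ball x₀ r₀)) →
      ∫⁻ x in Ω, ENNReal.ofReal (L x * ‖G x‖ ^ p) ≠ ⊤ →
      ∫⁻ x in Metric.ball x₀ r₀, ENNReal.ofReal (L x) ^ (-s) ≠ ⊤ →
      (∀ (ψ : EuclideanSpace ℝ (Fin N) → ℝ)
        (H : EuclideanSpace ℝ (Fin N) → EuclideanSpace ℝ (Fin N)), MemD p Ω L ψ H →
        ∫ x in Ω, L x * ‖G x‖ ^ (p - 2) * inner ℝ (G x) (H x) =
          lam * ∫ x in Ω, K x * |u x| ^ (p - 2) * u x * ψ x) →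
      eLpNorm u ⊤ (volume.restrict (Metric.ball x₀ (r₀ / 2))) ≤ C *
        ((∫⁻ x in Metric.ball x₀ r₀, ENNReal.ofReal (L x) ^ (-s)) ^ (1 / s) *
          (eLpNorm L (weightExponent p q) (volume.restrict (Metric.ball x₀ r₀)) +
            eLpNorm K (weightExponent p q) (volume.restrict (Metric.ball x₀ r₀)))) ^
          (1 / (μ * p)) *
        (∫⁻ x in Metric.ball x₀ r₀, ‖u x‖ₑ ^ q) ^ (1 / q) := by
  have hp0 : 0 < p := by linarith
  have hq0 : 0 < q := by linarith
  -- One step multiplies the exponent by `τ/q = 1/x`, and `∑ x^k = 1/μ`.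
  set x := 1 - μ with hx
  have hx0 : 0 < x := by linarith
  have hx1 : x < 1 := by linarith
  set τ := q / x with hτ
  have hqτ : q ≤ τ := by
    rw [hτ, le_div_iff₀ hx0]
    nlinarith
  have hτ0 : 0 < τ := by positivity
  obtain ⟨C, hC, hstep⟩ := exists_lintegral_rpow_le_moser hN (lam := lam) hp hs ha
    (haq.trans hqτ) hpq (by linarith) hκ hr₀
  set c := ENNReal.ofReal (1 + 4 / r₀) with hc
  -- At step `k`, the radius gap contributes a factor of order `2^k` and `β` equals `x^{-k}`;
  -- together they are at most `c (2/x)^k`. `T` is the sum of `k x^k`.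
  set b := ENNReal.ofReal (2 / x) ^ p with hb
  set T := x / (1 - x) ^ 2 with hT
  have hcp : c ^ p ≠ ⊤ := ENNReal.rpow_ne_top_of_nonneg hp0.le ENNReal.ofReal_ne_top
  have hbt : b ≠ ⊤ := ENNReal.rpow_ne_top_of_nonneg hp0.le ENNReal.ofReal_ne_top
  have hT0 : 0 < T := by
    have : 0 < 1 - x := by linarith
    positivity
  refine ⟨(C * c ^ p) ^ (1 / (μ * p)) * b ^ (T / p), ENNReal.mul_ne_top
    (ENNReal.rpow_ne_top_of_nonneg (by positivity) (ENNReal.mul_ne_top hC hcp))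
    (ENNReal.rpow_ne_top_of_nonneg (by positivity) hbt), ?_⟩
  intro Ω L K u G φ x₀ h hL hB hLB hKB hG hΛ hweak
  set 𝒜 := (∫⁻ x in Metric.ball x₀ r₀, ENNReal.ofReal (L x) ^ (-s)) ^ (1 / s) *
    (eLpNorm L (weightExponent p q) (volume.restrict (Metric.ball x₀ r₀)) +
      eLpNorm K (weightExponent p q) (volume.restrict (Metric.ball x₀ r₀))) with h𝒜
  have h𝒜t : 𝒜 ≠ ⊤ := ENNReal.mul_ne_top (ENNReal.rpow_ne_top_of_nonneg (by positivity) hΛ)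
    (ENNReal.add_ne_top.2 ⟨hLB.2.ne, hKB.2.ne⟩)
  set Q := C * 𝒜 * c ^ p with hQ
  have hQt : Q ≠ ⊤ := ENNReal.mul_ne_top (ENNReal.mul_ne_top hC h𝒜t) hcp
  -- These radii start at `r₀` for `k = 0` and decrease to `r₀/2`.
  set r : ℕ → ℝ := fun k => r₀ / 2 * (1 + (1 / 2) ^ k) with hr
  set a : ℕ → ℝ≥0∞ := fun k => (∫⁻ y in Metric.ball x₀ (r k), ‖u y‖ₑ ^ (q / x ^ k)) ^ (x ^ k / q)
    with ha'
  have hstep' : ∀ k, a (k + 1) ≤ (Q * b ^ k) ^ (x ^ k / p) * a k := fun k => by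
    have hxk : 0 < x ^ k := by positivity
    have hxk1 : x ^ k ≤ 1 := pow_le_one₀ hx0.le hx1.le
    have hh : (0 : ℝ) < (1 / 2) ^ k := by positivity
    have hh1 : ((1 : ℝ) / 2) ^ k ≤ 1 := pow_le_one₀ (by norm_num) (by norm_num)
    have hdiff : r k - r (k + 1) = r₀ / 4 * (1 / 2) ^ k := by
      simp only [hr, pow_succ]
      ring
    have hrk1 : 0 < r (k + 1) := by simp only [hr]; positivity
    have hrk : r k ≤ r₀ := by
      simp only [hr]
      nlinarith
    have hlt : r (k + 1) < r k := by
      have : 0 < r₀ / 4 * (1 / 2) ^ k := by positivity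
      linarith
    have h1 := hstep h hL hB hKB.1.aemeasurable hLB.2.ne hG hΛ hweak (β := (x ^ k)⁻¹)
      ((one_le_inv₀ hxk).2 hxk1) hrk1 hlt hrk
    have e1 : (x ^ k)⁻¹ * τ = q / x ^ (k + 1) := by
      rw [hτ, pow_succ]
      field_simp
    have e2 : (x ^ k)⁻¹ * q = q / x ^ k := by ring
    rw [e1, e2] at h1
    have hfac : ENNReal.ofReal (1 + 1 / (r k - r (k + 1))) * ENNReal.ofReal (x ^ k)⁻¹ ≤
        c * ENNReal.ofReal (2 / x) ^ k := by
      rw [hdiff, hc, ← ENNReal.ofReal_pow (by positivity), ← ENNReal.ofReal_mul (by positivity),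
        ← ENNReal.ofReal_mul (by positivity)]
      refine ENNReal.ofReal_le_ofReal ?_
      have : 1 + 1 / (r₀ / 4 * (1 / 2) ^ k) ≤ (1 + 4 / r₀) * 2 ^ k := by
        have e : 1 / (r₀ / 4 * (1 / 2) ^ k) = 4 / r₀ * 2 ^ k := by
          rw [one_div, mul_inv, inv_div, one_div, inv_pow, inv_inv]
        rw [e, add_mul, one_mul]
        gcongr
        exact one_le_pow₀ one_le_two
      calc _ ≤ (1 + 4 / r₀) * 2 ^ k * (x ^ k)⁻¹ := by gcongr
        _ = _ := by rw [div_pow]; ring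
    have h2 := ENNReal.rpow_le_rpow h1 (show 0 ≤ x ^ (k + 1) / q by positivity)
    refine h2.trans ?_
    rw [← ENNReal.rpow_mul, show τ / p * (x ^ (k + 1) / q) = x ^ k / p by
      rw [hτ, pow_succ]; field_simp]
    calc _ ≤ (C * 𝒜 * (c * ENNReal.ofReal (2 / x) ^ k) ^ p *
          (∫⁻ y in Metric.ball x₀ (r k), ‖u y‖ₑ ^ (q / x ^ k)) ^ (p / q)) ^ (x ^ k / p) := by
          gcongr
      _ = _ := by
          rw [ENNReal.mul_rpow_of_nonneg _ _ (by positivity : 0 ≤ x ^ k / p), ← ENNReal.rpow_mul,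
            show p / q * (x ^ k / p) = x ^ k / q by field_simp,
            ENNReal.mul_rpow_of_nonneg _ _ hp0.le, hQ, hb, ← ENNReal.rpow_natCast,
            ← ENNReal.rpow_natCast, ← ENNReal.rpow_mul, ← ENNReal.rpow_mul, mul_comm (k : ℝ) p,
            ← mul_assoc]
  have hiter := le_rpow_sum_mul hp0 hx0 hstep'
  have ha0 : a 0 = (∫⁻ x in Metric.ball x₀ r₀, ‖u x‖ₑ ^ q) ^ (1 / q) := by
    simp only [ha', hr]
    norm_num
  have ha0t : a 0 ≠ ⊤ := by
    rw [ha0]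
    exact ENNReal.rpow_ne_top_of_nonneg (by positivity)
      (h.lintegral_rpow_lt_top (by linarith)).ne
  have hS : Tendsto (fun k => (∑ j ∈ Finset.range k, x ^ j) / p) atTop (𝓝 (1 / (μ * p))) := by
    have := (hasSum_geometric_of_lt_one hx0.le hx1).tendsto_sum_nat.div_const p
    rwa [show (1 - x)⁻¹ / p = 1 / (μ * p) by
      rw [hx, sub_sub_cancel, one_div, mul_inv, div_eq_mul_inv]] at this
  have hTs : Tendsto (fun k => (∑ j ∈ Finset.range k, (j : ℝ) * x ^ j) / p) atTop
      (𝓝 (T / p)) :=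
    (hasSum_coe_mul_geometric_of_norm_lt_one (r := x)
      (by rwa [Real.norm_of_nonneg hx0.le])).tendsto_sum_nat.div_const p
  have hlim : Tendsto (fun k => Q ^ ((∑ j ∈ Finset.range k, x ^ j) / p) *
      b ^ ((∑ j ∈ Finset.range k, (j : ℝ) * x ^ j) / p) * a 0) atTop
      (𝓝 (Q ^ (1 / (μ * p)) * b ^ (T / p) * a 0)) :=
    ENNReal.Tendsto.mul_const (ENNReal.Tendsto.mul
      (tendsto_const_rpow_of_pos hQt (by positivity) hS)
      (.inr (ENNReal.rpow_ne_top_of_nonneg (by positivity) hbt))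
      (tendsto_const_rpow_of_pos hbt (by positivity) hTs)
      (.inr (ENNReal.rpow_ne_top_of_nonneg (by positivity) hQt))) (.inr ha0t)
  have hu : AEStronglyMeasurable u (volume.restrict (Metric.ball x₀ (r₀ / 2))) :=
    h.aestronglyMeasurable.mono_measure (Measure.restrict_mono
      ((Metric.ball_subset_ball (by linarith)).trans hB) le_rfl)
  have : IsFiniteMeasure (volume.restrict (Metric.ball x₀ (r₀ / 2))) :=
    ⟨by simpa using measure_ball_lt_top⟩
  have hfinal := eLpNorm_top_le_of_tendsto (σ := fun k => q / x ^ k) hu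
    (fun k => by positivity) ?_ (fun k => ?_) hlim
  · refine hfinal.trans (le_of_eq ?_)
    rw [ha0, hQ, mul_right_comm C, ENNReal.mul_rpow_of_nonneg (C * c ^ p) 𝒜 (by positivity)]
    ring
  · have h1 : Tendsto (fun k : ℕ => (x⁻¹) ^ k) atTop atTop :=
      tendsto_pow_atTop_atTop_of_one_lt ((one_lt_inv₀ hx0).2 hx1)
    have := h1.const_mul_atTop hq0
    refine this.congr fun k => ?_
    rw [inv_pow, div_eq_mul_inv]
  · refine le_trans ?_ (hiter k)
    simp only [ha', one_div_div]
    refine ENNReal.rpow_le_rpow (lintegral_mono_set (Metric.ball_subset_ball ?_)) (by positivity)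
    simp only [hr]
    have : (0 : ℝ) < (1 / 2) ^ k := by positivity
    nlinarith

/-- For `α < N` this is the strict inequality `τ < α^*` rewritten. For `α ≥ N` every finite `τ`
qualifies, since already `N/α ≤ 1`. -/
theorem mul_one_div_sub_one_div_lt_one (hN : 1 ≤ N) {α τ : ℝ} (hα : 0 < α) (hτ : 0 < τ)
    (h : ENNReal.ofReal τ < sobolevExponent N α) : N * (1 / α - 1 / τ) < 1 := by
  have hN0 : (0 : ℝ) < N := by exact_mod_cast hN
  unfold sobolevExponent at h
  split_ifs at h with hlt
  · rw [ENNReal.ofReal_lt_ofReal_iff_of_nonneg hτ.le, lt_div_iff₀ (by linarith)] at h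
    rw [one_div, one_div, inv_sub_inv hα.ne' hτ.ne', ← mul_div_assoc, div_lt_one (by positivity)]
    linarith
  · have h1 : N * (1 / α) ≤ 1 := by
      rw [mul_one_div, div_le_one hα]
      linarith
    have h2 : 0 < N * (1 / τ) := by positivity
    linarith

theorem ofReal_div_one_sub_lt {q μ : ℝ} {P : ℝ≥0∞} (hq : ENNReal.ofReal q < P) (hq0 : 0 < q)
    (hμ : μ < 1 - (ENNReal.ofReal q / P).toReal) : ENNReal.ofReal (q / (1 - μ)) < P := by
  rcases eq_or_ne P ⊤ with rfl | hP
  · exact ENNReal.ofReal_lt_top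
  · rw [ENNReal.toReal_div, ENNReal.toReal_ofReal hq0.le] at hμ
    have hP0 : 0 < P.toReal := ENNReal.toReal_pos (ne_bot_of_gt hq) hP
    have h1 : q / P.toReal < 1 - μ := by linarith
    have h2 : 0 < q / P.toReal := by positivity
    rw [ENNReal.ofReal_lt_iff_lt_toReal (div_nonneg hq0.le (by linarith)) hP,
      div_lt_iff₀ (by linarith)]
    rw [div_lt_iff₀ hP0] at h1
    linarith

theorem toReal_div_lt_one {q : ℝ} {P : ℝ≥0∞} (hq : ENNReal.ofReal q < P) :
    (ENNReal.ofReal q / P).toReal < 1 := by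
  have h : ENNReal.ofReal q / P < 1 := by
    rcases eq_or_ne P ⊤ with rfl | hP
    · simp
    · rw [ENNReal.div_lt_iff (.inl (ne_bot_of_gt hq)) (.inl hP), one_mul]
      exact hq
  simpa using (ENNReal.toReal_lt_toReal h.ne_top ENNReal.one_ne_top).2 h

theorem Weights.isWeight {R₁ : ℝ} {R₂ : EReal} {L K : EuclideanSpace ℝ (Fin N) → ℝ}
    (h : Weights R₁ R₂ L K) : IsWeight (annulus N R₁ R₂) L :=
  ⟨h.aemeasurable_L, h.pos_L, h.locallyIntegrable_L⟩

theorem isOpen_annulus (R₁ : ℝ) (R₂ : EReal) : IsOpen (annulus N R₁ R₂) :=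
  (isOpen_lt continuous_const continuous_norm).inter
    (isOpen_lt (continuous_coe_real_ereal.comp continuous_norm) continuous_const)

/-- Translates the exponents: `s ≥ 1/(p-1)` is `p_s ≥ 1`, always `p_s ≤ p ≤ q`, and both `q` (for
the approximation) and `q/(1-μ)` (for the iteration) are subcritical. -/
theorem local_boundedness (hN : 1 ≤ N) {p s q lam : ℝ} (hp : 1 < p)
    (hs' : 1 / (p - 1) ≤ s) (hpq : p ≤ q)
    (hq : ENNReal.ofReal q < sobolevExponent N (pSub p s)) {r₀ : ℝ} (hr₀ : 0 < r₀) {μ : ℝ}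
    (hμ : 0 < μ) (hμq : μ < 1 - (ENNReal.ofReal q / sobolevExponent N (pSub p s)).toReal) :
    ∃ C : ℝ, 0 < C ∧
      ∀ (R₁ : ℝ) (R₂ : EReal) (L K : EuclideanSpace ℝ (Fin N) → ℝ), Weights R₁ R₂ L K →
        ∀ x₀ : EuclideanSpace ℝ (Fin N), Metric.ball x₀ r₀ ⊆ annulus N R₁ R₂ →
        IntegrableOn (fun x => L x ^ (-s)) (Metric.ball x₀ r₀) →
        MemLp L (weightExponent p q) (volume.restrict (Metric.ball x₀ r₀)) →
        MemLp K (weightExponent p q) (volume.restrict (Metric.ball x₀ r₀)) →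
        ∀ u : EuclideanSpace ℝ (Fin N) → ℝ, IsWeakSolution p lam (annulus N R₁ R₂) L K u →
          MemLp u (ENNReal.ofReal q) (volume.restrict (Metric.ball x₀ r₀)) ∧
          MemLp u ⊤ (volume.restrict (Metric.ball x₀ (r₀ / 2))) ∧
          eLpNorm u ⊤ (volume.restrict (Metric.ball x₀ (r₀ / 2))) ≤
            ENNReal.ofReal C * weightConstant p q s μ (Metric.ball x₀ r₀) L K *
              eLpNorm u (ENNReal.ofReal q) (volume.restrict (Metric.ball x₀ r₀)) := by
  have hp0 : 0 < p := by linarith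
  have hq0 : 0 < q := by linarith
  have hs0 : 0 < s := lt_of_lt_of_le (by have : 0 < p - 1 := by linarith
                                         positivity) hs'
  have hμ1 : μ < 1 := hμq.trans_le (sub_le_self _ ENNReal.toReal_nonneg)
  have ha : 1 ≤ pSub p s := by
    rw [div_le_iff₀ (by linarith)] at hs'
    rw [pSub, le_div_iff₀ (by linarith)]
    linarith
  have hap : pSub p s ≤ p := by
    rw [pSub, div_le_iff₀ (by linarith)]
    linarith
  have hκq := mul_one_div_sub_one_div_lt_one hN (by linarith : 0 < pSub p s) hq0 hq
  have hκ := mul_one_div_sub_one_div_lt_one hN (by linarith : 0 < pSub p s)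
    (div_pos hq0 (by linarith)) (ofReal_div_one_sub_lt hq hq0 hμq)
  obtain ⟨C, hC, hmain⟩ := exists_eLpNorm_top_le hN (lam := lam) hp hs0 ha (hap.trans hpq) hpq hμ
    hμ1 hκ hr₀
  -- Adding `1` makes the constant strictly positive.
  refine ⟨C.toReal + 1, by positivity, ?_⟩
  intro R₁ R₂ L K hW x₀ hB hΛ hLB hKB u hu
  obtain ⟨G, hmem, hweak⟩ := hu
  have hL := hW.isWeight
  have hpos := ae_mono (Measure.restrict_mono hB le_rfl) hL.pos
  have hΛeq : ∫⁻ x in Metric.ball x₀ r₀, ENNReal.ofReal (L x) ^ (-s) =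
      ∫⁻ x in Metric.ball x₀ r₀, ENNReal.ofReal (L x ^ (-s)) := by
    refine lintegral_congr_ae ?_
    filter_upwards [hpos] with x hx using ENNReal.ofReal_rpow_of_pos hx
  have hΛt : ∫⁻ x in Metric.ball x₀ r₀, ENNReal.ofReal (L x) ^ (-s) ≠ ⊤ := by
    rw [hΛeq]
    exact ((lintegral_mono fun x => Real.ofReal_le_enorm _).trans_lt hΛ.2).ne
  obtain ⟨φ, hφ⟩ := hmem.exists_isApprox hL hp hs0 ha (hap.trans hpq) (by linarith) hκq hr₀ hB hΛt
  have hG := (hmem.lintegral_gradient_lt_top hL hp).ne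
  have hest := hmain hφ hL hB hLB hKB hG hΛt hweak
  have huq := hφ.lintegral_rpow_lt_top (by linarith)
  have hnorm : eLpNorm u (ENNReal.ofReal q) (volume.restrict (Metric.ball x₀ r₀)) =
      (∫⁻ x in Metric.ball x₀ r₀, ‖u x‖ₑ ^ q) ^ (1 / q) := by
    rw [eLpNorm_eq_lintegral_rpow_enorm_toReal (by simpa using hq0) ENNReal.ofReal_ne_top,
      ENNReal.toReal_ofReal hq0.le]
  have hweight : weightConstant p q s μ (Metric.ball x₀ r₀) L K =
      ((∫⁻ x in Metric.ball x₀ r₀, ENNReal.ofReal (L x) ^ (-s)) ^ (1 / s) *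
        (eLpNorm L (weightExponent p q) (volume.restrict (Metric.ball x₀ r₀)) +
          eLpNorm K (weightExponent p q) (volume.restrict (Metric.ball x₀ r₀)))) ^
        (1 / (μ * p)) := by
    rw [weightConstant, hΛeq, ENNReal.mul_rpow_of_nonneg _ _ (by positivity), ← ENNReal.rpow_mul]
    congr 2
    field_simp
  have hunorm : eLpNorm u (ENNReal.ofReal q) (volume.restrict (Metric.ball x₀ r₀)) < ⊤ := by
    rw [hnorm]
    exact ENNReal.rpow_lt_top_of_nonneg (by positivity) huq.ne
  have hMt : weightConstant p q s μ (Metric.ball x₀ r₀) L K ≠ ⊤ := by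
    rw [hweight]
    exact ENNReal.rpow_ne_top_of_nonneg (by positivity) (ENNReal.mul_ne_top
      (ENNReal.rpow_ne_top_of_nonneg (by positivity) hΛt)
      (ENNReal.add_ne_top.2 ⟨hLB.2.ne, hKB.2.ne⟩))
  have hum := hφ.aestronglyMeasurable.mono_measure (Measure.restrict_mono hB le_rfl)
  have hfinal : eLpNorm u ⊤ (volume.restrict (Metric.ball x₀ (r₀ / 2))) ≤
      ENNReal.ofReal (C.toReal + 1) * weightConstant p q s μ (Metric.ball x₀ r₀) L K *
        eLpNorm u (ENNReal.ofReal q) (volume.restrict (Metric.ball x₀ r₀)) := by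
    rw [hweight, hnorm]
    refine hest.trans ?_
    gcongr
    calc C = ENNReal.ofReal C.toReal := (ENNReal.ofReal_toReal hC).symm
      _ ≤ _ := ENNReal.ofReal_le_ofReal (by linarith)
  exact ⟨⟨hum, hunorm⟩, ⟨hum.mono_measure (Measure.restrict_mono
    (Metric.ball_subset_ball (by linarith)) le_rfl), hfinal.trans_lt (ENNReal.mul_lt_top
      (ENNReal.mul_lt_top ENNReal.ofReal_lt_top hMt.lt_top) hunorm)⟩, hfinal⟩

/-- Essential boundedness passes to subsets and finite unions, so compactness globalizes it. -/
theorem memLp_top_of_isCompact {S : Set (EuclideanSpace ℝ (Fin N))} (hS : IsCompact S)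
    {u : EuclideanSpace ℝ (Fin N) → ℝ} (hu : AEStronglyMeasurable u (volume.restrict S))
    (h : ∀ x ∈ S, ∃ r > 0, MemLp u ⊤ (volume.restrict (Metric.ball x r))) :
    MemLp u ⊤ (volume.restrict S) := by
  obtain ⟨c, hc⟩ : ∃ c : ℝ, ∀ᵐ x ∂volume.restrict S, ‖u x‖ ≤ c := by
    refine hS.induction_on (p := fun S => ∃ c : ℝ, ∀ᵐ x ∂volume.restrict S, ‖u x‖ ≤ c)
      ⟨0, by simp⟩ (fun S T hST ⟨c, hc⟩ => ⟨c, ae_mono (Measure.restrict_mono hST le_rfl) hc⟩)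
      (fun S T ⟨c, hc⟩ ⟨c', hc'⟩ => ⟨max c c', ?_⟩) fun x hx => ?_
    · rw [ae_restrict_union_iff]
      exact ⟨hc.mono fun x hx => hx.trans (le_max_left _ _),
        hc'.mono fun x hx => hx.trans (le_max_right _ _)⟩
    · obtain ⟨r, hr, hur⟩ := h x hx
      refine ⟨Metric.ball x r, mem_nhdsWithin_of_mem_nhds (Metric.ball_mem_nhds x hr),
        (eLpNorm u ⊤ (volume.restrict (Metric.ball x r))).toReal, ?_⟩
      have := enorm_ae_le_eLpNormEssSup u (volume.restrict (Metric.ball x r))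
      filter_upwards [this] with y hy
      rw [← toReal_enorm, eLpNorm_exponent_top]
      exact ENNReal.toReal_mono (by rw [← eLpNorm_exponent_top]; exact hur.2.ne) hy
  exact memLp_top_of_bound hu c hc

end

end

end WeightedPLaplacian

theorem theorem1p4 (N : ℕ) (hN : 1 ≤ N) (p s q lam : ℝ) (hp : 1 < p)
    (hs : (N : ℝ) / p < s) (hs' : 1 / (p - 1) ≤ s) (hpq : p ≤ q)
    (hq : ENNReal.ofReal q <
      WeightedPLaplacian.sobolevExponent N (WeightedPLaplacian.pSub p s)) :
    (∀ r₀ : ℝ, 0 < r₀ → ∀ μ : ℝ, 0 < μ →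
      μ < 1 - (ENNReal.ofReal q /
        WeightedPLaplacian.sobolevExponent N (WeightedPLaplacian.pSub p s)).toReal →
      ∃ C : ℝ, 0 < C ∧
        ∀ (R₁ : ℝ) (R₂ : EReal) (L K : EuclideanSpace ℝ (Fin N) → ℝ),
          0 < R₁ → (R₁ : EReal) < R₂ →
          WeightedPLaplacian.Weights R₁ R₂ L K →
          WeightedPLaplacian.ConditionA p R₁ R₂ L K →
          ∀ x₀ : EuclideanSpace ℝ (Fin N),
            Metric.ball x₀ r₀ ⊆ WeightedPLaplacian.annulus N R₁ R₂ →
            IntegrableOn (fun x => L x ^ (-s)) (Metric.ball x₀ r₀) →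
            MemLp L (WeightedPLaplacian.weightExponent p q)
              (volume.restrict (Metric.ball x₀ r₀)) →
            MemLp K (WeightedPLaplacian.weightExponent p q)
              (volume.restrict (Metric.ball x₀ r₀)) →
            ∀ u : EuclideanSpace ℝ (Fin N) → ℝ,
              WeightedPLaplacian.IsWeakSolution p lam (WeightedPLaplacian.annulus N R₁ R₂)
                L K u →
              MemLp u (ENNReal.ofReal q) (volume.restrict (Metric.ball x₀ r₀)) ∧
              MemLp u ⊤ (volume.restrict (Metric.ball x₀ (r₀ / 2))) ∧
              eLpNorm u ⊤ (volume.restrict (Metric.ball x₀ (r₀ / 2))) ≤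
                ENNReal.ofReal C *
                  WeightedPLaplacian.weightConstant p q s μ (Metric.ball x₀ r₀) L K *
                  eLpNorm u (ENNReal.ofReal q) (volume.restrict (Metric.ball x₀ r₀))) ∧
    (∀ (R₁ : ℝ) (R₂ : EReal) (L K : EuclideanSpace ℝ (Fin N) → ℝ),
      0 < R₁ → (R₁ : EReal) < R₂ →
      WeightedPLaplacian.Weights R₁ R₂ L K →
      WeightedPLaplacian.ConditionA p R₁ R₂ L K →
      (∀ S ⊆ WeightedPLaplacian.annulus N R₁ R₂, IsCompact S →
        IntegrableOn (fun x => L x ^ (-s)) S ∧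
        MemLp L (WeightedPLaplacian.weightExponent p q) (volume.restrict S) ∧
        MemLp K (WeightedPLaplacian.weightExponent p q) (volume.restrict S)) →
      ∀ u : EuclideanSpace ℝ (Fin N) → ℝ,
        WeightedPLaplacian.IsWeakSolution p lam (WeightedPLaplacian.annulus N R₁ R₂) L K u →
        ∀ S ⊆ WeightedPLaplacian.annulus N R₁ R₂, IsCompact S →
          MemLp u ⊤ (volume.restrict S)) := by
  open WeightedPLaplacian in
  refine ⟨fun r₀ hr₀ μ hμ hμq => ?_, ?_⟩
  · obtain ⟨C, hC, h⟩ := local_boundedness hN (lam := lam) hp hs' hpq hq hr₀ hμ hμq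
    exact ⟨C, hC, fun R₁ R₂ L K _ _ hW _ => h R₁ R₂ L K hW⟩
  · intro R₁ R₂ L K _ _ hW _ hloc u hu S hS hSc
    -- Any admissible `μ` will do; one exists because `q` is strictly below the Sobolev exponent.
    obtain ⟨μ, hμ, hμq⟩ := exists_between (sub_pos.2 (toReal_div_lt_one hq))
    have hum : AEStronglyMeasurable u (volume.restrict S) := by
      obtain ⟨G, hmem, -⟩ := hu
      exact hmem.1.mono_measure (Measure.restrict_mono hS le_rfl)
    refine memLp_top_of_isCompact hSc hum fun x hx => ?_
    -- The closed ball is a compact subset of the annulus, so the local hypotheses on the weights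
    -- apply to it.
    obtain ⟨r, hr, hball⟩ := Metric.nhds_basis_closedBall.mem_iff.1
      ((isOpen_annulus R₁ R₂).mem_nhds (hS hx))
    obtain ⟨C, -, h⟩ := local_boundedness hN (lam := lam) hp hs' hpq hq hr hμ hμq
    obtain ⟨h1, h2, h3⟩ := hloc _ hball (isCompact_closedBall x r)
    have hle : volume.restrict (Metric.ball x r) ≤ volume.restrict (Metric.closedBall x r) :=
      Measure.restrict_mono Metric.ball_subset_closedBall le_rfl
    exact ⟨r / 2, by positivity, (h R₁ R₂ L K hW x (Metric.ball_subset_closedBall.trans hball)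
      (h1.mono_set Metric.ball_subset_closedBall) (h2.mono_measure hle) (h3.mono_measure hle)
      u hu).2.1⟩
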